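/- Let $W\subseteq\mathbb{R}^2$ be a fixed closed wedge, i.e. the intersection of two closed halfplanes with non-parallel bounding lines (so its angle lies in $(0,\pi)$), and for $q\in\mathbb{R}^2$ let $W_q=q+W$. Then there is a data structure (on the real RAM with $O(\log n)$-bit integer words) that stores any given set $S$ of $n$ points in $\mathbb{R}^2$ in $O(n)$ space, such that for every query point $q\in\mathbb{R}^2$ a closest pair of distinct points (in the Euclidean metric) of $S\cap W_q$ is reported, or it is reported that $S\cap W_q$ has fewer than two points, in $O(\log n)$ time. The query program and the constants hidden in the $O(\cdot)$-notation depend only on $W$. -/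

import Mathlib

open Filter Asymptotics

/-- The Euclidean plane. -/
abbrev Plane : Type := EuclideanSpace ℝ (Fin 2)

/-- A (closed) wedge: the intersection of two closed halfplanes whose bounding lines are not
parallel, i.e. a closed convex angular region of some angle strictly between `0` and `π`, with
an arbitrary vertex. -/
def IsWedge (W : Set Plane) : Prop :=
  ∃ (a b : Plane) (α β : ℝ), LinearIndependent ℝ ![a, b] ∧
    W = {x : Plane | α ≤ inner ℝ a x ∧ β ≤ inner ℝ b x}

/-- The translate `q + Γ`. -/
def translateOf (Γ : Set Plane) (q : Plane) : Set Plane :=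
  (fun x => q + x) '' Γ

/-- `a, b` is a closest pair of distinct points of `A`. -/
def IsClosestPair (A : Set Plane) (a b : Plane) : Prop :=
  a ∈ A ∧ b ∈ A ∧ a ≠ b ∧ ∀ x ∈ A, ∀ y ∈ A, x ≠ y → dist a b ≤ dist x y

namespace RealRAM

/-! The real RAM: a random access machine with a memory of integer words (of bounded word
length) and a memory of exact real numbers, both with indirect addressing, and with integer and
real registers. Reals can be added, subtracted, multiplied, divided and compared; there is no
rounding and no other conversion of reals to integers. Each instruction costs one time unit. -/

/-- Instructions. `d` is the target register, `s, s'` are source registers, `p` is an integer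
register that holds an address, and `l` is the position of an instruction in the program. -/
inductive Instr : Type
  | iconst (d : ℕ) (k : ℕ)
  | icopy (d s : ℕ)
  | iadd (d s s' : ℕ)
  | isub (d s s' : ℕ)
  | ihalf (d s : ℕ)
  | iload (d p : ℕ)
  | istore (p s : ℕ)
  | rconst (d : ℕ) (x : ℝ)
  | rcopy (d s : ℕ)
  | radd (d s s' : ℕ)
  | rsub (d s s' : ℕ)
  | rmul (d s s' : ℕ)
  | rdiv (d s s' : ℕ)
  | rload (d p : ℕ)
  | rstore (p s : ℕ)
  | jump (l : ℕ)
  | jumpIfILt (s s' l : ℕ)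
  | jumpIfRLt (s s' l : ℕ)
  | halt

/-- A program is a finite list of instructions; in particular it mentions only finitely many
registers and finitely many constants. -/
abbrev Program : Type := List Instr

/-- The contents of the memory: finitely many integer words and finitely many reals. -/
structure Memory : Type where
  ints : List ℕ
  reals : List ℝ

/-- The number of memory cells. -/
def Memory.size (M : Memory) : ℕ := M.ints.length + M.reals.length

/-- A configuration: program counter, integer registers, real registers, memory. -/
structure Config : Type where
  pc : ℕ
  ireg : ℕ → ℕ
  rreg : ℕ → ℝ
  mem : Memory

/-- Put `v` into the integer register `d` and go to the next instruction. -/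
def Config.setI (c : Config) (d v : ℕ) : Config :=
  { c with pc := c.pc + 1, ireg := Function.update c.ireg d v }

/-- Put `x` into the real register `d` and go to the next instruction. -/
noncomputable def Config.setR (c : Config) (d : ℕ) (x : ℝ) : Config :=
  { c with pc := c.pc + 1, rreg := Function.update c.rreg d x }

/-- One step of the machine whose integer words hold the numbers below `B`. There is no next
configuration (`none`) after `halt`, at a position outside the program, at an overflow, at a
division by zero, and at an access outside the memory. The size of the memory never changes. -/
noncomputable def step (B : ℕ) (P : Program) (c : Config) : Option Config :=
  match P[c.pc]? with
  | none => none
  | some (.iconst d k) => if k < B then some (c.setI d k) else none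
  | some (.icopy d s) => some (c.setI d (c.ireg s))
  | some (.iadd d s s') =>
      if c.ireg s + c.ireg s' < B then some (c.setI d (c.ireg s + c.ireg s')) else none
  | some (.isub d s s') => some (c.setI d (c.ireg s - c.ireg s'))
  | some (.ihalf d s) => some (c.setI d (c.ireg s / 2))
  | some (.iload d p) => (c.mem.ints[c.ireg p]?).map fun v => c.setI d v
  | some (.istore p s) =>
      if c.ireg p < c.mem.ints.length then
        some { c with
          pc := c.pc + 1
          mem := { c.mem with ints := c.mem.ints.set (c.ireg p) (c.ireg s) } }
      else none
  | some (.rconst d x) => some (c.setR d x)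
  | some (.rcopy d s) => some (c.setR d (c.rreg s))
  | some (.radd d s s') => some (c.setR d (c.rreg s + c.rreg s'))
  | some (.rsub d s s') => some (c.setR d (c.rreg s - c.rreg s'))
  | some (.rmul d s s') => some (c.setR d (c.rreg s * c.rreg s'))
  | some (.rdiv d s s') =>
      if c.rreg s' = 0 then none else some (c.setR d (c.rreg s / c.rreg s'))
  | some (.rload d p) => (c.mem.reals[c.ireg p]?).map fun x => c.setR d x
  | some (.rstore p s) =>
      if c.ireg p < c.mem.reals.length then
        some { c with
          pc := c.pc + 1
          mem := { c.mem with reals := c.mem.reals.set (c.ireg p) (c.rreg s) } }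
      else none
  | some (.jump l) => some { c with pc := l }
  | some (.jumpIfILt s s' l) =>
      some { c with pc := if c.ireg s < c.ireg s' then l else c.pc + 1 }
  | some (.jumpIfRLt s s' l) =>
      some { c with pc := if c.rreg s < c.rreg s' then l else c.pc + 1 }
  | some .halt => none

/-- `Exec B P c τ c'`: started in `c`, the program `P` runs for exactly `τ` steps and then
reaches a `halt` instruction, in configuration `c'`. -/
inductive Exec (B : ℕ) (P : Program) : Config → ℕ → Config → Prop
  | halt (c : Config) : P[c.pc]? = some Instr.halt → Exec B P c 0 c
  | step (c c' c'' : Config) (τ : ℕ) :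
      RealRAM.step B P c = some c' → Exec B P c' τ c'' → Exec B P c (τ + 1) c''

/-- The initial configuration for the query point `q` on the stored data `M`: the coordinates of
`q` are in the real registers `0` and `1`, and all other registers are `0`. -/
noncomputable def queryConfig (M : Memory) (q : Plane) : Config where
  pc := 0
  ireg := fun _ => 0
  rreg := fun i => if i = 0 then q 0 else if i = 1 then q 1 else 0
  mem := M

/-- The configuration `c` reports a closest pair of `A`, or that there is none: either integer
register `0` is `1` and real registers `0, 1, 2, 3` hold the coordinates of the two points of a
closest pair of `A`, or integer register `0` is `0` and `A` has at most one point. -/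
def ReportsClosestPair (A : Set Plane) (c : Config) : Prop :=
  (c.ireg 0 = 1 ∧ IsClosestPair A !₂[c.rreg 0, c.rreg 1] !₂[c.rreg 2, c.rreg 3]) ∨
    (c.ireg 0 = 0 ∧ A.Subsingleton)

end RealRAM

/-- There is a range closest-pair data structure for the translates of `Γ` which, on every set of
`n` points, has at most `space n` memory cells and query time at most `time n`. One query program
serves all point sets. For each finite set `S` of points there is a memory content (the stored
data structure) on which the program answers every query `q + Γ`. The integer words hold the
numbers below `(n + 2) ^ k` for a constant `k`, that is, they have `O(log n)` bits. -/
def HasRCPDataStructure (Γ : Set Plane) (space time : ℕ → ℕ) : Prop :=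
  ∃ (P : RealRAM.Program) (k : ℕ), ∀ S : Finset Plane, ∃ M : RealRAM.Memory,
    M.size ≤ space S.card ∧
    (∀ v ∈ M.ints, v < (S.card + 2) ^ k) ∧
    ∀ q : Plane, ∃ (τ : ℕ) (c : RealRAM.Config),
      τ ≤ time S.card ∧
      RealRAM.Exec ((S.card + 2) ^ k) P (RealRAM.queryConfig M q) τ c ∧
      RealRAM.ReportsClosestPair ((S : Set Plane) ∩ translateOf Γ q) c

/-! With `U = ⟨a, ·⟩` and `V = ⟨b, ·⟩`, every query asks for a closest pair among the points with `U
≥ x` and `V ≥ y`. Order all pairs of points by distance, with ties broken. The first pair in the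
query quadrant is also first in the smaller quadrant that it spans, so only pairs with the latter
property matter.

There are linearly many of these. If one point of such a pair is the corner of the spanned quadrant,
it determines the pair. Otherwise the pair is charged to one of its points together with one of
finitely many direction classes (`card_antichain_pairs_le`). If both charges failed, two shorter
pairs in nearly the same direction would force `U` and `V` both to be small on the difference
vector, which linear independence forbids. Hence `exists_candidate_sequence`: a query asks for the
first index `i` in a sorted list of `m = O(n)` pairs with `x ≤ u i` and `y ≤ v i`.

This is point location in a planar subdivision. For fixed `x` the possible answers are the strict
record maxima of `v` among the indices with `x ≤ u i`, followed by the sentinel `m`; they form a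
staircase. As `x` varies, at most `2 * m` pairs of indices are ever neighbours on it
(`card_consecutivePairs_le`), each over one interval of `x`. A binary tree over the indices is
descended: at a node the only useful comparison is with the step that crosses its midpoint, if one
exists; otherwise a marker, an index known to lie on the staircase, tells the side. Fractional
cascading keeps the position of `x` known at constant cost per level (`HasSearch.merge`), which
gives `exists_search`. Finally a fixed program interprets the stored records (`Reach.exec`). -/

namespace RangeClosestPair

/-! ### Ranks in finite sets of reals, and halving -/

/-- The number of elements of `X` below `x`. -/
noncomputable def cnt (X : Finset ℝ) (x : ℝ) : ℕ := (X.filter (· < x)).card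

theorem cnt_mono (X : Finset ℝ) {x x' : ℝ} (h : x ≤ x') : cnt X x ≤ cnt X x' := by
  apply Finset.card_le_card
  intro b hb
  simp only [Finset.mem_filter] at hb ⊢
  exact ⟨hb.1, hb.2.trans_le h⟩

theorem cnt_le_card (X : Finset ℝ) (x : ℝ) : cnt X x ≤ X.card := Finset.card_filter_le _ _

theorem filter_lt_eq_of_cnt_eq {X : Finset ℝ} {x x' : ℝ} (h : cnt X x = cnt X x') :
    X.filter (· < x) = X.filter (· < x') := by
  rcases le_total x x' with hx | hx
  · apply Finset.eq_of_subset_of_card_le _ h.ge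
    intro b hb
    simp only [Finset.mem_filter] at hb ⊢
    exact ⟨hb.1, hb.2.trans_le hx⟩
  · symm
    apply Finset.eq_of_subset_of_card_le _ h.le
    intro b hb
    simp only [Finset.mem_filter] at hb ⊢
    exact ⟨hb.1, hb.2.trans_le hx⟩

theorem lt_iff_lt_of_cnt_eq {X : Finset ℝ} {x x' e : ℝ} (h : cnt X x = cnt X x') (he : e ∈ X) :
    e < x ↔ e < x' := by
  have := congrArg (e ∈ ·) (filter_lt_eq_of_cnt_eq h)
  simpa [he] using this

theorem cnt_eq_of_subset {X Y : Finset ℝ} (hYX : Y ⊆ X) {x x' : ℝ} (h : cnt X x = cnt X x') :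
    cnt Y x = cnt Y x' := by
  unfold cnt
  congr 1
  apply Finset.filter_congr
  intro e he
  exact lt_iff_lt_of_cnt_eq h (hYX he)

theorem cnt_lt_cnt {X : Finset ℝ} {e x : ℝ} (he : e ∈ X) (hx : e < x) : cnt X e < cnt X x := by
  apply Finset.card_lt_card
  rw [Finset.ssubset_iff_of_subset]
  · exact ⟨e, by simp [he, hx], by simp⟩
  · intro b hb
    simp only [Finset.mem_filter] at hb ⊢
    exact ⟨hb.1, hb.2.trans hx⟩

theorem cnt_injOn (X : Finset ℝ) : Set.InjOn (cnt X) X := by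
  intro e he e' he' h
  rcases lt_trichotomy e e' with hlt | heq | hlt
  · exact absurd h (cnt_lt_cnt he hlt).ne
  · exact heq
  · exact absurd h (cnt_lt_cnt he' hlt).ne'

theorem image_cnt_filter_lt (X : Finset ℝ) (x : ℝ) :
    (X.filter (· < x)).image (cnt X) = Finset.range (cnt X x) := by
  apply Finset.eq_of_subset_of_card_le
  · intro r hr
    simp only [Finset.mem_image, Finset.mem_filter, Finset.mem_range] at hr ⊢
    obtain ⟨e, ⟨he, hx⟩, rfl⟩ := hr
    exact cnt_lt_cnt he hx
  · rw [Finset.card_range, Finset.card_image_of_injOn]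
    · rfl
    · exact (cnt_injOn X).mono fun e he => (Finset.mem_filter.mp he).1

theorem exists_mem_cnt_eq {X : Finset ℝ} {r : ℕ} (hr : r < X.card) : ∃ e ∈ X, cnt X e = r := by
  have h : X.image (cnt X) = Finset.range X.card := by
    apply Finset.eq_of_subset_of_card_le
    · intro r hr
      simp only [Finset.mem_image, Finset.mem_range] at hr ⊢
      obtain ⟨e, he, rfl⟩ := hr
      apply Finset.card_lt_card
      rw [Finset.ssubset_iff_of_subset (Finset.filter_subset _ _)]
      exact ⟨e, he, by simp⟩
    · rw [Finset.card_range, Finset.card_image_of_injOn (cnt_injOn X)]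
  have : r ∈ X.image (cnt X) := by rw [h]; simpa using hr
  simpa using this

theorem card_filter_odd_range (n : ℕ) : ((Finset.range n).filter Odd).card = n / 2 := by
  induction n with
  | zero => rfl
  | succ n ih =>
    rw [Finset.range_add_one, Finset.filter_insert]
    split_ifs with h
    · rw [Finset.card_insert_of_notMem (by simp), ih]
      obtain ⟨k, rfl⟩ := h
      omega
    · rw [ih]
      rw [Nat.not_odd_iff_even] at h
      obtain ⟨k, rfl⟩ := h
      omega

/-- Every other element of `X`. -/
noncomputable def half (X : Finset ℝ) : Finset ℝ := X.filter fun e => Odd (cnt X e)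

theorem half_subset (X : Finset ℝ) : half X ⊆ X := Finset.filter_subset _ _

/-- The elements below `x` have exactly the ranks `0, …, cnt X x - 1`, and the odd ones among these
number half, rounded down. -/
theorem cnt_half (X : Finset ℝ) (x : ℝ) : cnt (half X) x = cnt X x / 2 := by
  rw [← card_filter_odd_range, ← image_cnt_filter_lt, Finset.filter_image,
    Finset.card_image_of_injOn]
  · unfold cnt half
    rw [Finset.filter_comm]
    rfl
  · exact (cnt_injOn X).mono (by intro e; simp +contextual)

theorem two_mul_card_half_le (X : Finset ℝ) : 2 * (half X).card ≤ X.card := by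
  have h : ∃ x : ℝ, ∀ e ∈ X, e < x := by
    obtain ⟨b, hb⟩ := X.exists_le
    exact ⟨b + 1, fun e he => (hb e he).trans_lt (lt_add_one b)⟩
  obtain ⟨x, hx⟩ := h
  have h1 : cnt (half X) x = (half X).card := by
    unfold cnt
    rw [Finset.filter_true_of_mem fun e he => hx e (half_subset X he)]
  have h2 := cnt_half X x
  have h3 := cnt_le_card X x
  omega

/-- In a cell of a set that contains every other element of `X`, one comparison determines the
cell of `X`. -/
theorem exists_cnt_eq_ite {X Y : Finset ℝ} (hXY : half X ⊆ Y) (x₀ : ℝ) :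
    ∃ (e : ℝ) (p q : ℕ), ∀ x, cnt Y x = cnt Y x₀ → cnt X x = if x ≤ e then p else q := by
  set h := cnt (half X) x₀ with hh
  have key : ∀ x, cnt Y x = cnt Y x₀ → cnt X x / 2 = h := by
    intro x hx
    rw [← cnt_half, hh]
    exact cnt_eq_of_subset hXY hx
  -- Only the ranks `2 * h` and `2 * h + 1` remain; the element of rank `2 * h` separates them. If
  -- there is no such element, the rank is `2 * h` and the comparison is a dummy.
  by_cases hc : 2 * h < X.card
  · obtain ⟨e, he, hr⟩ := exists_mem_cnt_eq hc
    refine ⟨e, 2 * h, 2 * h + 1, fun x hx => ?_⟩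
    have h1 := key x hx
    split_ifs with hxe
    · have := cnt_mono X hxe
      omega
    · have := cnt_lt_cnt he (not_le.mp hxe)
      omega
  · refine ⟨0, 2 * h, 2 * h, fun x hx => ?_⟩
    have h1 := key x hx
    have h2 := cnt_le_card X x
    split_ifs <;> omega

/-! ### Search records -/

/-- The records of the search structure: a comparison of the first coordinate of the query, a
comparison of the second coordinate that also moves the marker, a comparison of the marker, and
an answer. -/
inductive Rec : Type
  | xt (c : ℝ) (a b : ℕ)
  | yt (c : ℝ) (j k a b : ℕ)
  | wt (mid a b : ℕ)
  | found (i : ℕ)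

/-- Started at position `p` with marker `w`, the search for `(x, y)` ends with the answer `i`
after at most `d` comparisons, and every marker it meets is at most `K`. -/
inductive Reach (K : ℕ) (G : List Rec) (x y : ℝ) : ℕ → ℕ → ℕ → ℕ → Prop
  | found {p w d i : ℕ} : G[p]? = some (.found i) → Reach K G x y p w d i
  | xt {p w d i : ℕ} (c : ℝ) (a b : ℕ) : G[p]? = some (.xt c a b) →
      Reach K G x y (if x ≤ c then a else b) w d i → Reach K G x y p w (d + 1) i
  | yt {p w d i : ℕ} (c : ℝ) (j k a b : ℕ) : G[p]? = some (.yt c j k a b) → j ≤ K → k ≤ K →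
      Reach K G x y (if y ≤ c then a else b) (if y ≤ c then j else k) d i →
      Reach K G x y p w (d + 1) i
  | wt {p w d i : ℕ} (mid a b : ℕ) : G[p]? = some (.wt mid a b) → mid ≤ K →
      Reach K G x y (if w < mid then a else b) w d i → Reach K G x y p w (d + 1) i

theorem getElem?_of_prefix {α : Type*} {G G' : List α} (h : G <+: G') {p : ℕ} {r : α}
    (hp : G[p]? = some r) : G'[p]? = some r := by
  obtain ⟨t, rfl⟩ := h
  obtain ⟨hlt, h2⟩ := List.getElem?_eq_some_iff.mp hp
  rw [List.getElem?_append_left hlt, hp]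

/-- Structures are built only by appending records, so positions stored earlier stay valid. -/
theorem Reach.of_prefix {K : ℕ} {G G' : List Rec} (h : G <+: G') {x y : ℝ} {p w d i : ℕ}
    (hr : Reach K G x y p w d i) : Reach K G' x y p w d i := by
  induction hr with
  | found hp => exact .found (getElem?_of_prefix h hp)
  | xt c a b hp _ ih => exact .xt c a b (getElem?_of_prefix h hp) ih
  | yt c j k a b hp hj hk _ ih => exact .yt c j k a b (getElem?_of_prefix h hp) hj hk ih
  | wt mid a b hp hm _ ih => exact .wt mid a b (getElem?_of_prefix h hp) hm ih

/-- Records for finitely many cells can be appended one cell after the other. -/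
theorem exists_extension_forall (P : ℕ → List Rec → ℕ → Prop)
    (hP : ∀ r G G' p, G <+: G' → P r G p → P r G' p) (s : ℕ) (G : List Rec)
    (hstep : ∀ r G₁, G <+: G₁ → ∃ G₂, G₁ <+: G₂ ∧ G₂.length ≤ G₁.length + s ∧ ∃ p, P r G₂ p)
    (n : ℕ) :
    ∃ G', G <+: G' ∧ G'.length ≤ G.length + s * n ∧ ∃ e : ℕ → ℕ, ∀ r < n, P r G' (e r) := by
  induction n with
  | zero => exact ⟨G, List.prefix_rfl, by simp, fun _ => 0, by simp⟩
  | succ n ih =>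
    obtain ⟨G₁, h1, hl, e, he⟩ := ih
    obtain ⟨G₂, h2, hl2, p, hp⟩ := hstep n G₁ h1
    refine ⟨G₂, h1.trans h2, by rw [mul_add]; omega, Function.update e n p, fun r hr => ?_⟩
    by_cases hrn : r = n
    · subst hrn
      simpa using hp
    · rw [Function.update_of_ne hrn]
      exact hP _ _ _ _ h2 (he r (by omega))

/-! ### Staircases -/

section Staircase

variable (m : ℕ) (u v : ℕ → ℝ)

/-- `i` is the first index below `m` with `x ≤ u i` and `y ≤ v i`; it is `m` if there is none. -/
def IsFirst (x y : ℝ) (i : ℕ) : Prop :=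
  i ≤ m ∧ (i < m → x ≤ u i ∧ y ≤ v i) ∧ ∀ i' < i, ¬ (x ≤ u i' ∧ y ≤ v i')

/-- The index `k` is the answer to some query with first coordinate `x`. -/
def Alive (x : ℝ) (k : ℕ) : Prop :=
  k ≤ m ∧ (k < m → x ≤ u k) ∧ (k < m → ∀ i < k, x ≤ u i → v i < v k)

/-- The indices `j < k` are consecutive on the staircase at `x`. -/
def Consecutive (x : ℝ) (j k : ℕ) : Prop :=
  Alive m u v x j ∧ Alive m u v x k ∧ j < k ∧ ∀ i, j < i → i < k → ¬ Alive m u v x i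

/-- The indices that separate `j` from `k`, or hide `j`, where they are active. -/
def Hides (j k i : ℕ) : Prop := i < k ∧ (i < j ∧ v j ≤ v i ∨ j < i ∧ v j < v i)

variable {m u v}

theorem exists_isFirst (x y : ℝ) : ∃ i, IsFirst m u v x y i := by
  classical
  have h : ∃ i, i = m ∨ (i < m ∧ x ≤ u i ∧ y ≤ v i) := ⟨m, Or.inl rfl⟩
  refine ⟨Nat.find h, Nat.find_min' h (Or.inl rfl), fun hi => ?_, fun i' hi' hh => ?_⟩
  · rcases Nat.find_spec h with h1 | h1
    · omega
    · exact h1.2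
  · have h1 : Nat.find h ≤ m := Nat.find_min' h (Or.inl rfl)
    exact Nat.find_min h hi' (Or.inr ⟨by omega, hh⟩)

theorem IsFirst.alive {x y : ℝ} {i : ℕ} (h : IsFirst m u v x y i) : Alive m u v x i := by
  refine ⟨h.1, fun hi => (h.2.1 hi).1, fun hi i' hi' hx => ?_⟩
  have h1 := h.2.2 i' hi'
  have h2 := (h.2.1 hi).2
  have : ¬ y ≤ v i' := fun hy => h1 ⟨hx, hy⟩
  linarith [not_le.mp this]

theorem alive_last (x : ℝ) : Alive m u v x m :=
  ⟨le_rfl, fun h => absurd h (lt_irrefl _), fun h => absurd h (lt_irrefl _)⟩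

theorem Alive.le_of_le {x : ℝ} {j k : ℕ} (hj : Alive m u v x j) (hk : Alive m u v x k)
    (hkm : k < m) (hjk : j ≤ k) : v j ≤ v k := by
  rcases hjk.eq_or_lt with rfl | h
  · exact le_rfl
  · exact (hk.2.2 hkm j h (hj.2.1 (by omega))).le

/-- For fixed `j` and `k` the right side only bounds `x`: weakly above by `u j` and `u k`, strictly
below by the `u i` of the hiding indices. The admissible `x` thus form one interval, open on the
left and closed on the right. -/
theorem consecutive_iff {x : ℝ} {j k : ℕ} :
    Consecutive m u v x j k ↔
      j < k ∧ k ≤ m ∧ x ≤ u j ∧ (k < m → x ≤ u k ∧ v j < v k) ∧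
        ∀ i, Hides v j k i → u i < x := by
  constructor
  · rintro ⟨hj, hk, hjk, hno⟩
    have hjm : j < m := hjk.trans_le hk.1
    refine ⟨hjk, hk.1, hj.2.1 hjm, fun hkm => ⟨hk.2.1 hkm, hk.2.2 hkm j hjk (hj.2.1 hjm)⟩, ?_⟩
    have hlow : ∀ i < j, x ≤ u i → v i < v j := hj.2.2 hjm
    rintro i ⟨hik, h | h⟩
    · by_contra hx
      exact absurd (hlow i h.1 (not_lt.mp hx)) (not_lt.mpr h.2)
    -- If active, `i` would be alive unless an earlier active index is at least as high. That index
    -- would again lie between `j` and `k` and above `v j`, contrary to induction.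
    · induction i using Nat.strong_induction_on with
      | _ i ih =>
        by_contra hx
        refine hno i h.1 hik ⟨hik.le.trans hk.1, fun _ => not_lt.mp hx, fun _ i' hi' hx' => ?_⟩
        rcases lt_trichotomy i' j with h1 | h1 | h1
        · exact (hlow i' h1 hx').trans h.2
        · rw [h1]; exact h.2
        · by_contra hv
          exact absurd (ih i' hi' (by omega) ⟨h1, h.2.trans_le (not_lt.mp hv)⟩) (not_lt.mpr hx')
  · rintro ⟨hjk, hkm, hxj, hk, hh⟩
    have hlow : ∀ i < j, x ≤ u i → v i < v j := fun i hi hx => by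
      by_contra hv
      exact absurd (hh i ⟨by omega, Or.inl ⟨hi, not_lt.mp hv⟩⟩) (not_lt.mpr hx)
    have hbetween : ∀ i, j < i → i < k → x ≤ u i → v i ≤ v j := fun i hi hik hx => by
      by_contra hv
      exact absurd (hh i ⟨hik, Or.inr ⟨hi, not_le.mp hv⟩⟩) (not_lt.mpr hx)
    refine ⟨⟨by omega, fun _ => hxj, fun _ => hlow⟩,
      ⟨hkm, fun h => (hk h).1, fun h i hi hx => ?_⟩, hjk, fun i hi hik ha => ?_⟩
    · have h2 := (hk h).2
      rcases lt_trichotomy i j with h1 | h1 | h1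
      · exact (hlow i h1 hx).trans h2
      · rw [h1]; exact h2
      · exact (hbetween i h1 hi hx).trans_lt h2
    · have him : i < m := by omega
      exact absurd (ha.2.2 him j hi hxj) (not_lt.mpr (hbetween i hi hik (ha.2.1 him)))

/-- Two numbers delimit the range in which `j` and `k` are consecutive. -/
theorem exists_breakpoints (j k : ℕ) :
    ∃ F : Finset ℝ, F.card ≤ 2 ∧ ∀ x x', cnt F x = cnt F x' →
      Consecutive m u v x j k → Consecutive m u v x' j k := by
  classical
  -- The right end of the interval of `x`. The left end is the largest `u i` over the hiding
  -- indices, if there are any.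
  let r : ℝ := if k < m then min (u j) (u k) else u j
  let H : Finset ℕ := (Finset.range k).filter fun i => Hides v j k i
  have hH : ∃ F : Finset ℝ, F.card ≤ 1 ∧ ∀ x x', cnt F x = cnt F x' →
      (∀ i, Hides v j k i → u i < x) → ∀ i, Hides v j k i → u i < x' := by
    by_cases hne : H.Nonempty
    · obtain ⟨i₀, hi₀, hmax⟩ := H.exists_max_image u hne
      refine ⟨{u i₀}, by simp, fun x x' hc hx i hi => ?_⟩
      have h1 : u i₀ < x' :=
        (lt_iff_lt_of_cnt_eq hc (Finset.mem_singleton_self _)).mp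
          (hx i₀ (Finset.mem_filter.mp hi₀).2)
      exact (hmax i (Finset.mem_filter.mpr ⟨Finset.mem_range.mpr hi.1, hi⟩)).trans_lt h1
    · refine ⟨∅, by simp, fun x x' _ _ i hi => ?_⟩
      exact absurd ⟨i, Finset.mem_filter.mpr ⟨Finset.mem_range.mpr hi.1, hi⟩⟩ hne
  obtain ⟨F, hF, hFx⟩ := hH
  refine ⟨insert r F, (Finset.card_insert_le _ _).trans (by omega), fun x x' hc h => ?_⟩
  rw [consecutive_iff] at h ⊢
  obtain ⟨hjk, hkm, hxj, hk, hh⟩ := h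
  have hr : x ≤ r := by
    simp only [r]
    split_ifs with hlt
    · exact le_min hxj (hk hlt).1
    · exact hxj
  have hr' : x' ≤ r := by
    have := lt_iff_lt_of_cnt_eq hc (Finset.mem_insert_self r F)
    exact not_lt.mp fun hlt => absurd (this.mpr hlt) (not_lt.mpr hr)
  refine ⟨hjk, hkm, ?_, fun hlt => ⟨?_, (hk hlt).2⟩,
    hFx x x' (cnt_eq_of_subset (Finset.subset_insert _ _) hc) hh⟩
  · refine hr'.trans ?_
    simp only [r]
    split_ifs
    · exact min_le_left _ _
    · exact le_rfl
  · refine hr'.trans ?_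
    simp only [r, if_pos hlt]
    exact min_le_right _ _

/-- The interval contains its right end, which is `u j` or `u k`. This lets each pair be charged to
one of its own indices. -/
theorem Consecutive.at_endpoint {x : ℝ} {j k : ℕ} (h : Consecutive m u v x j k) :
    Consecutive m u v (u j) j k ∨ k < m ∧ Consecutive m u v (u k) j k := by
  simp only [consecutive_iff] at h ⊢
  obtain ⟨hjk, hkm, hxj, hk, hh⟩ := h
  by_cases hlt : k < m
  · rcases le_total (u j) (u k) with huv | huv
    · exact Or.inl ⟨hjk, hkm, le_rfl, fun _ => ⟨huv, (hk hlt).2⟩,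
        fun i hi => (hh i hi).trans_le hxj⟩
    · exact Or.inr ⟨hlt, hjk, hkm, huv, fun _ => ⟨le_rfl, (hk hlt).2⟩,
        fun i hi => (hh i hi).trans_le (hk hlt).1⟩
  · exact Or.inl ⟨hjk, hkm, le_rfl, fun h => absurd h hlt, fun i hi => (hh i hi).trans_le hxj⟩

theorem Consecutive.right_unique {x : ℝ} {j k k' : ℕ} (h : Consecutive m u v x j k)
    (h' : Consecutive m u v x j k') : k = k' := by
  rcases lt_trichotomy k k' with hlt | heq | hlt
  · exact absurd h.2.1 (h'.2.2.2 k h.2.2.1 hlt)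
  · exact heq
  · exact absurd h'.2.1 (h.2.2.2 k' h'.2.2.1 hlt)

theorem Consecutive.left_unique {x : ℝ} {j j' k : ℕ} (h : Consecutive m u v x j k)
    (h' : Consecutive m u v x j' k) : j = j' := by
  rcases lt_trichotomy j j' with hlt | heq | hlt
  · exact absurd h'.1 (h.2.2.2 j' hlt h'.2.2.1)
  · exact heq
  · exact absurd h.1 (h'.2.2.2 j hlt h.2.2.1)

variable (m u v) in
open Classical in
/-- The pairs of indices that are consecutive somewhere. -/
noncomputable def consecutivePairs : Finset (ℕ × ℕ) :=
  (Finset.range m ×ˢ Finset.range (m + 1)).filter fun p => ∃ x, Consecutive m u v x p.1 p.2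

theorem mem_consecutivePairs {x : ℝ} {j k : ℕ} (h : Consecutive m u v x j k) :
    (j, k) ∈ consecutivePairs m u v := by
  have h1 := h.2.1.1
  have h2 := h.2.2.1
  simp only [consecutivePairs, Finset.mem_filter, Finset.mem_product, Finset.mem_range]
  exact ⟨⟨by omega, by omega⟩, x, h⟩

/-- A pair is charged to `j` if it is consecutive at `u j`, and to `k < m` at `u k` otherwise. At a
given `x` an index has at most one successor and one predecessor, so each index is charged at most
twice. -/
theorem card_consecutivePairs_le : (consecutivePairs m u v).card ≤ 2 * m := by
  classical
  let f : ℕ × ℕ → ℕ × Bool := fun p =>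
    if Consecutive m u v (u p.1) p.1 p.2 then (p.1, true) else (p.2, false)
  have hcard : (Finset.range m ×ˢ (Finset.univ : Finset Bool)).card = 2 * m := by
    rw [Finset.card_product]
    simp [mul_comm]
  rw [← hcard]
  have hmem : ∀ p ∈ consecutivePairs m u v, p.1 < m ∧
      (¬ Consecutive m u v (u p.1) p.1 p.2 → p.2 < m ∧ Consecutive m u v (u p.2) p.1 p.2) := by
    intro p hp
    simp only [consecutivePairs, Finset.mem_filter, Finset.mem_product, Finset.mem_range] at hp
    obtain ⟨⟨h1, -⟩, x, hx⟩ := hp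
    exact ⟨h1, fun hn => hx.at_endpoint.resolve_left hn⟩
  apply Finset.card_le_card_of_injOn f
  · intro p hp
    have := hmem p hp
    simp only [f, Finset.coe_product, Finset.coe_range, Finset.coe_univ, Set.mem_prod, Set.mem_Iio,
      Set.mem_univ, and_true]
    split_ifs with h
    · exact this.1
    · exact (this.2 h).1
  · rintro ⟨j, k⟩ hp ⟨j', k'⟩ hp' hff
    have h1 := (hmem _ hp).2
    have h2 := (hmem _ hp').2
    simp only [f] at hff h1 h2
    split_ifs at hff with ha hb hb
    · simp only [Prod.mk.injEq, and_true] at hff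
      subst hff
      rw [ha.right_unique hb]
    · simp at hff
    · simp at hff
    · simp only [Prod.mk.injEq, and_true] at hff
      subst hff
      rw [(h1 ha).2.left_unique (h2 hb).2]

/-- Two alive indices on different sides of `mid` enclose two consecutive ones. -/
theorem exists_consecutive_across {x : ℝ} {lo mid hi i w : ℕ} (hi1 : Alive m u v x i)
    (hw : Alive m u v x w) (hlo : lo ≤ i) (him : i < mid) (hmw : mid ≤ w) (hwh : w < hi) :
    ∃ j k, lo ≤ j ∧ j < mid ∧ mid ≤ k ∧ k < hi ∧ Consecutive m u v x j k := by
  classical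
  have hk : ∃ k, mid ≤ k ∧ Alive m u v x k := ⟨w, hmw, hw⟩
  let J : Finset ℕ := (Finset.range mid).filter fun j => Alive m u v x j
  have hiJ : i ∈ J := by simp [J, him, hi1]
  obtain ⟨j, hjJ, hjmax⟩ := J.exists_max_image id ⟨i, hiJ⟩
  simp only [J, Finset.mem_filter, Finset.mem_range] at hjJ
  have hks := Nat.find_spec hk
  have hkw : Nat.find hk ≤ w := Nat.find_min' hk ⟨hmw, hw⟩
  refine ⟨j, Nat.find hk, hlo.trans (hjmax i hiJ), hjJ.1, hks.1, by omega, hjJ.2, hks.2,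
    by omega, fun i' h1 h2 ha => ?_⟩
  by_cases h3 : i' < mid
  · have := hjmax i' (by simp [J, h3, ha])
    simp only [id] at this
    omega
  · exact Nat.find_min hk h2 ⟨not_lt.mp h3, ha⟩

end Staircase

/-! ### Point location by a tree over the indices with fractional cascading -/

section Search

variable {K m : ℕ} {u v : ℕ → ℝ}

/-- The search for `(x, y)` from position `p` succeeds in `d` comparisons if the answer and the
marker belong to `[lo, hi)`. -/
def Solves (K m : ℕ) (u v : ℕ → ℝ) (G : List Rec) (lo hi d : ℕ) (x : ℝ) (p : ℕ) : Prop :=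
  ∀ y w i, Alive m u v x w → lo ≤ w → w < hi → IsFirst m u v x y i → lo ≤ i → i < hi →
    Reach K G x y p w d i

/-- The records `G` contain a search structure for the answers in `[lo, hi)`, with one entry
position for each cell of `X`. -/
def HasSearch (K m : ℕ) (u v : ℕ → ℝ) (G : List Rec) (lo hi d : ℕ) (X : Finset ℝ) : Prop :=
  ∃ e : ℕ → ℕ, ∀ x, Solves K m u v G lo hi d x (e (cnt X x))

theorem Solves.of_prefix {G G' : List Rec} (h : G <+: G') {lo hi d : ℕ} {x : ℝ} {p : ℕ}
    (hs : Solves K m u v G lo hi d x p) : Solves K m u v G' lo hi d x p :=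
  fun y w i h1 h2 h3 h4 h5 h6 => (hs y w i h1 h2 h3 h4 h5 h6).of_prefix h

theorem HasSearch.of_prefix {G G' : List Rec} (h : G <+: G') {lo hi d : ℕ} {X : Finset ℝ}
    (hs : HasSearch K m u v G lo hi d X) : HasSearch K m u v G' lo hi d X :=
  let ⟨e, he⟩ := hs
  ⟨e, fun x => (he x).of_prefix h⟩

/-- Appending the same number of records for each cell of `X`. -/
theorem exists_hasSearch_of_cells {lo hi d : ℕ} (X : Finset ℝ) (s : ℕ) (G : List Rec)
    (hstep : ∀ x₀ G₁, G <+: G₁ → ∃ G₂, G₁ <+: G₂ ∧ G₂.length ≤ G₁.length + s ∧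
      ∃ p, ∀ x, cnt X x = cnt X x₀ → Solves K m u v G₂ lo hi d x p) :
    ∃ G', G <+: G' ∧ G'.length ≤ G.length + s * (X.card + 1) ∧
      HasSearch K m u v G' lo hi d X := by
  obtain ⟨G', h1, h2, e, he⟩ := exists_extension_forall
    (fun r G p => ∀ x, cnt X x = r → Solves K m u v G lo hi d x p)
    (fun r G G' p hG hp x hx => (hp x hx).of_prefix hG) s G
    (fun r G₁ hG₁ => by
      by_cases hr : ∃ x₀, cnt X x₀ = r
      · obtain ⟨x₀, rfl⟩ := hr
        exact hstep x₀ G₁ hG₁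
      · exact ⟨G₁, List.prefix_rfl, by omega, 0, fun x hx => absurd ⟨x, hx⟩ hr⟩)
    (X.card + 1)
  exact ⟨G', h1, h2, e, fun x => he _ (Nat.lt_succ_of_le (cnt_le_card X x)) x rfl⟩

theorem reach_xt_of_cnt {G : List Rec} {lo hi d : ℕ} {x : ℝ} {e : ℕ → ℕ} {X : Finset ℝ}
    (he : ∀ x, Solves K m u v G lo hi d x (e (cnt X x))) {c : ℝ} {p q P : ℕ}
    (hc : cnt X x = if x ≤ c then p else q) (hP : G[P]? = some (.xt c (e p) (e q))) :
    Solves K m u v G lo hi (d + 1) x P := by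
  intro y w i h1 h2 h3 h4 h5 h6
  refine .xt c _ _ hP ?_
  have := he x y w i h1 h2 h3 h4 h5 h6
  rw [hc] at this
  split_ifs at this ⊢ <;> exact this

/-- A cell of `X` lies in one cell of `E`, so its crossing step, if any, is fixed, and one
comparison each recovers the cells of `XL` and `XR`. Three records per cell suffice: two such
comparisons and the test that chooses between them. A search passes two of the three. Only half of
each child's breakpoints move up. -/
theorem HasSearch.merge {G : List Rec} {lo mid hi d : ℕ} {XL XR E : Finset ℝ} (hmK : m ≤ K)
    (hmid : mid ≤ K) (hL : HasSearch K m u v G lo mid d XL) (hR : HasSearch K m u v G mid hi d XR)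
    (hE : ∀ x x', cnt E x = cnt E x' → ∀ j k, lo ≤ j → j < mid → mid ≤ k → k < hi →
      Consecutive m u v x j k → Consecutive m u v x' j k) :
    ∃ G' X, G <+: G' ∧ 2 * X.card ≤ 2 * E.card + XL.card + XR.card ∧
      G'.length ≤ G.length + 3 * (X.card + 1) ∧ HasSearch K m u v G' lo hi (d + 2) X := by
  classical
  obtain ⟨eL, heL⟩ := hL
  obtain ⟨eR, heR⟩ := hR
  set X : Finset ℝ := E ∪ (half XL ∪ half XR) with hX
  have hcard : 2 * X.card ≤ 2 * E.card + XL.card + XR.card := by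
    have h1 := Finset.card_union_le E (half XL ∪ half XR)
    have h2 := Finset.card_union_le (half XL) (half XR)
    have h3 := two_mul_card_half_le XL
    have h4 := two_mul_card_half_le XR
    rw [hX]
    omega
  have hEX : E ⊆ X := Finset.subset_union_left
  have hLX : half XL ⊆ X := Finset.subset_union_left.trans Finset.subset_union_right
  have hRX : half XR ⊆ X := Finset.subset_union_right.trans Finset.subset_union_right
  obtain ⟨G', h1, h2, h3⟩ := exists_hasSearch_of_cells (K := K) (m := m) (u := u) (v := v)
    (lo := lo) (hi := hi) (d := d + 2) X 3 G fun x₀ G₁ hG => by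
      obtain ⟨cL, pL, qL, hcL⟩ := exists_cnt_eq_ite hLX x₀
      obtain ⟨cR, pR, qR, hcR⟩ := exists_cnt_eq_ite hRX x₀
      by_cases hact : ∃ j k, lo ≤ j ∧ j < mid ∧ mid ≤ k ∧ k < hi ∧ Consecutive m u v x₀ j k
      · obtain ⟨j, k, hlj, hjm, hmk, hkh, hjk⟩ := hact
        refine ⟨G₁ ++ [.xt cL (eL pL) (eL qL), .xt cR (eR pR) (eR qR),
          .yt (v j) j k G₁.length (G₁.length + 1)], List.prefix_append _ _, by simp,
          G₁.length + 2, fun x hx => ?_⟩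
        have hpre := hG.trans (List.prefix_append G₁ [.xt cL (eL pL) (eL qL),
          .xt cR (eR pR) (eR qR), .yt (v j) j k G₁.length (G₁.length + 1)])
        have hsL := reach_xt_of_cnt (P := G₁.length) (fun x => (heL x).of_prefix hpre) (hcL x hx)
          (by simp)
        have hsR := reach_xt_of_cnt (P := G₁.length + 1) (fun x => (heR x).of_prefix hpre)
          (hcR x hx) (by simp)
        have hc : Consecutive m u v x j k :=
          hE x₀ x (cnt_eq_of_subset hEX hx.symm) j k hlj hjm hmk hkh hjk
        have hkm : k ≤ m := hc.2.1.1
        have hjm' : j < m := hc.2.2.1.trans_le hkm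
        intro y w i ha hlw hwh hf hli hih
        refine .yt (v j) j k G₁.length (G₁.length + 1) (by simp) (by omega) (by omega) ?_
        -- If `y ≤ v j`, then `j` itself qualifies and the answer is at most `j`. An answer below
        -- `mid` would be at most `j`, hence have `v i ≤ v j`, so it forces `y ≤ v j`. The new
        -- marker `j` or `k` is alive on the chosen side.
        by_cases hy : y ≤ v j
        · rw [if_pos hy, if_pos hy]
          have hij : i ≤ j := by
            by_contra hij
            exact hf.2.2 j (not_le.mp hij) ⟨hc.1.2.1 hjm', hy⟩
          exact hsL y j i hc.1 hlj hjm hf hli (by omega)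
        · rw [if_neg hy, if_neg hy]
          have hmi : mid ≤ i := by
            by_contra hmi
            have him : i < m := by omega
            have hij : i ≤ j := by
              by_contra hij
              exact hc.2.2.2 i (not_le.mp hij) (by omega) hf.alive
            exact hy ((hf.2.1 him).2.trans (hf.alive.le_of_le hc.1 hjm' hij))
          exact hsR y k i hc.2.1 hmk hkh hf hmi hih
      · refine ⟨G₁ ++ [.xt cL (eL pL) (eL qL), .xt cR (eR pR) (eR qR),
          .wt mid G₁.length (G₁.length + 1)], List.prefix_append _ _, by simp,
          G₁.length + 2, fun x hx => ?_⟩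
        have hpre := hG.trans (List.prefix_append G₁ [.xt cL (eL pL) (eL qL),
          .xt cR (eR pR) (eR qR), .wt mid G₁.length (G₁.length + 1)])
        have hsL := reach_xt_of_cnt (P := G₁.length) (fun x => (heL x).of_prefix hpre) (hcL x hx)
          (by simp)
        have hsR := reach_xt_of_cnt (P := G₁.length + 1) (fun x => (heR x).of_prefix hpre)
          (hcR x hx) (by simp)
        have hno : ¬ ∃ j k, lo ≤ j ∧ j < mid ∧ mid ≤ k ∧ k < hi ∧ Consecutive m u v x j k := by
          rintro ⟨j, k, a1, a2, a3, a4, hjk⟩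
          exact hact ⟨j, k, a1, a2, a3, a4,
            hE x x₀ (cnt_eq_of_subset hEX hx) j k a1 a2 a3 a4 hjk⟩
        intro y w i ha hlw hwh hf hli hih
        refine .wt mid G₁.length (G₁.length + 1) (by simp) hmid ?_
        -- Marker and answer are both alive; on different sides of `mid` they would enclose a
        -- crossing step, which this cell does not have.
        by_cases hw : w < mid
        · rw [if_pos hw]
          refine hsL y w i ha hlw hw hf hli ?_
          by_contra him
          exact hno (exists_consecutive_across ha hf.alive hlw hw (not_lt.mp him) hih)
        · rw [if_neg hw]
          refine hsR y w i ha (not_lt.mp hw) hwh hf ?_ hih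
          by_contra him
          exact hno (exists_consecutive_across hf.alive ha hli (not_le.mp him) (not_lt.mp hw) hwh)
  exact ⟨G', X, h1, hcard, h2, h3⟩

/-- The consecutive pairs with both indices in `[lo, hi)`. -/
noncomputable def pairsWithin (m : ℕ) (u v : ℕ → ℝ) (lo hi : ℕ) : Finset (ℕ × ℕ) :=
  (consecutivePairs m u v).filter fun p => lo ≤ p.1 ∧ p.2 < hi

theorem lt_of_mem_consecutivePairs {p : ℕ × ℕ} (hp : p ∈ consecutivePairs m u v) : p.1 < p.2 := by
  simp only [consecutivePairs, Finset.mem_filter] at hp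
  obtain ⟨-, x, hx⟩ := hp
  exact hx.2.2.1

/-- The term `3 * X.card + 3` is a potential: it pays for the halves of the breakpoints passed to
the parent, so the total stays linear. A crossing pair brings two breakpoints of cost `6` each,
hence the `12`; it is counted only at the node where it crosses. A leaf costs `1 + 3 = 4`. -/
theorem exists_hasSearch_range (hmK : m ≤ K) (h : ℕ) :
    ∀ lo : ℕ, lo + 2 ^ h ≤ K → ∀ G : List Rec,
    ∃ G' X, G <+: G' ∧
      G'.length + 3 * X.card + 3 ≤
        G.length + 12 * (pairsWithin m u v lo (lo + 2 ^ h)).card + 4 * 2 ^ h ∧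
      HasSearch K m u v G' lo (lo + 2 ^ h) (2 * h) X := by
  classical
  induction h with
  | zero =>
    intro lo _ G
    refine ⟨G ++ [.found lo], ∅, List.prefix_append _ _, by simp, fun _ => G.length,
      fun x y w i _ _ _ _ h5 h6 => ?_⟩
    have : i = lo := by simp at h6; omega
    subst this
    exact .found (by simp)
  | succ h ih =>
    intro lo hK G
    have hpow : 2 ^ (h + 1) = 2 ^ h + 2 ^ h := by rw [pow_succ]; ring
    set mid := lo + 2 ^ h with hmid
    have hhi : lo + 2 ^ (h + 1) = mid + 2 ^ h := by omega
    rw [hhi]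
    have hpos : 0 < 2 ^ h := by positivity
    obtain ⟨G₁, XL, hG1, hl1, hs1⟩ := ih lo (by omega) G
    rw [← hmid] at hl1 hs1
    obtain ⟨G₂, XR, hG2, hl2, hs2⟩ := ih mid (by omega) G₁
    choose F hFcard hF using fun p : ℕ × ℕ => exists_breakpoints (m := m) (u := u) (v := v) p.1 p.2
    let cross := (consecutivePairs m u v).filter fun p =>
      lo ≤ p.1 ∧ p.1 < mid ∧ mid ≤ p.2 ∧ p.2 < mid + 2 ^ h
    have hsplit : (pairsWithin m u v lo mid).card + (pairsWithin m u v mid (mid + 2 ^ h)).card +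
        cross.card ≤ (pairsWithin m u v lo (mid + 2 ^ h)).card := by
      rw [← Finset.card_union_of_disjoint, ← Finset.card_union_of_disjoint]
      · apply Finset.card_le_card
        intro p hp
        simp only [pairsWithin, cross, Finset.mem_union, Finset.mem_filter] at hp ⊢
        rcases hp with (⟨hp, h1⟩ | ⟨hp, h1⟩) | ⟨hp, h1⟩ <;> exact ⟨hp, by omega⟩
      · rw [Finset.disjoint_left]
        intro p hp
        simp only [pairsWithin, cross, Finset.mem_union, Finset.mem_filter] at hp ⊢
        omega
      · rw [Finset.disjoint_left]
        intro p hp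
        simp only [pairsWithin, Finset.mem_filter] at hp ⊢
        have := lt_of_mem_consecutivePairs hp.1
        omega
    let E := cross.biUnion F
    have hEcard : E.card ≤ 2 * cross.card := by
      have := Finset.card_biUnion_le_card_mul cross F 2 fun p _ => hFcard p
      rw [mul_comm]
      exact this
    obtain ⟨G', X, hG', hX, hl, hs⟩ := (hs1.of_prefix hG2).merge (E := E) hmK (by omega) hs2
      (fun x x' hxx j k h1 h2 h3 h4 hc => by
        have hp : (j, k) ∈ cross :=
          Finset.mem_filter.mpr ⟨mem_consecutivePairs hc, h1, h2, h3, h4⟩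
        exact hF (j, k) x x' (cnt_eq_of_subset (Finset.subset_biUnion_of_mem F hp) hxx) hc)
    refine ⟨G', X, hG1.trans (hG2.trans hG'), by omega, ?_⟩
    exact hs

theorem HasSearch.lift {G : List Rec} {lo hi d : ℕ} {X : Finset ℝ}
    (hs : HasSearch K m u v G lo hi d X) :
    ∃ G', G <+: G' ∧ G'.length ≤ G.length + ((half X).card + 1) ∧
      HasSearch K m u v G' lo hi (d + 1) (half X) := by
  obtain ⟨e, he⟩ := hs
  have := exists_hasSearch_of_cells (K := K) (m := m) (u := u) (v := v)
    (lo := lo) (hi := hi) (d := d + 1) (half X) 1 G fun x₀ G₁ hG => by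
      obtain ⟨c, p, q, hc⟩ := exists_cnt_eq_ite (subset_refl (half X)) x₀
      refine ⟨G₁ ++ [.xt c (e p) (e q)], List.prefix_append _ _, by simp, G₁.length,
        fun x hx => ?_⟩
      exact reach_xt_of_cnt (fun x => (he x).of_prefix (hG.trans (List.prefix_append _ _)))
        (hc x hx) (by simp)
  simpa using this

/-- Repeated halving is binary search for the cell of `x`: once no breakpoint is left, there is a
single entry position. -/
theorem HasSearch.lift_to_empty (L : ℕ) : ∀ {G : List Rec} {lo hi d : ℕ} {X : Finset ℝ},
    X.card < 2 ^ L → HasSearch K m u v G lo hi d X →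
    ∃ G', G <+: G' ∧ G'.length ≤ G.length + X.card + L ∧
      HasSearch K m u v G' lo hi (d + L) ∅ := by
  induction L with
  | zero =>
    intro G lo hi d X hX hs
    have : X = ∅ := by simpa using hX
    subst this
    exact ⟨G, List.prefix_rfl, by simp, hs⟩
  | succ L ih =>
    intro G lo hi d X hX hs
    obtain ⟨G₁, h1, hl1, hs1⟩ := hs.lift
    have hh := two_mul_card_half_le X
    obtain ⟨G₂, h2, hl2, hs2⟩ := ih (by rw [pow_succ] at hX; omega) hs1
    refine ⟨G₂, h1.trans h2, by omega, ?_⟩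
    rwa [show d + (L + 1) = d + 1 + L by ring]

/-- Among `m` points in the plane, the first one that dominates a query point can be found with
`O(log m)` comparisons, using `O(m)` records. -/
theorem exists_search (m : ℕ) (u v : ℕ → ℝ) : ∃ (G : List Rec) (s : ℕ),
    G.length ≤ 60 * (m + 1) ∧ s < G.length ∧
      ∀ x y i, IsFirst m u v x y i →
        Reach (2 * (m + 1)) G x y s 0 (3 * Nat.log 2 (m + 1) + 8) i := by
  set h := Nat.log 2 (m + 1) + 1 with hh
  have hlow : m + 1 < 2 ^ h := Nat.lt_pow_succ_log_self (by norm_num) _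
  have hup : 2 ^ h ≤ 2 * (m + 1) := by
    rw [hh, pow_succ, mul_comm]
    exact Nat.mul_le_mul_left _ (Nat.pow_log_le_self 2 (by omega))
  obtain ⟨G₁, X, -, hl1, hs1⟩ := exists_hasSearch_range (K := 2 * (m + 1)) (m := m) (u := u)
    (v := v) (by omega) h 0 (by omega) []
  have hpairs : (pairsWithin m u v 0 (0 + 2 ^ h)).card ≤ 2 * m :=
    (Finset.card_filter_le _ _).trans card_consecutivePairs_le
  simp only [List.length_nil] at hl1
  -- Indeed `3 * X.card ≤ 24 * m + 4 * 2 ^ h < 28 * 2 ^ h`.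
  have hXcard : X.card < 2 ^ (h + 4) := by rw [pow_add]; omega
  obtain ⟨G₂, -, hl2, e, he⟩ := HasSearch.lift_to_empty (h + 4) hXcard hs1
  have hloglt : h < 2 ^ h := Nat.lt_two_pow_self
  -- Both branches agree: this record only sets the marker to `m`, which is alive at every `x`.
  set r : Rec := .yt 0 m m (e 0) (e 0) with hr
  refine ⟨G₂ ++ [r], G₂.length, ?_, by simp, fun x y i hi => ?_⟩
  · simp only [List.length_append, List.length_singleton]
    omega
  · have hd : 3 * Nat.log 2 (m + 1) + 8 = 2 * h + (h + 4) + 1 := by omega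
    rw [hd]
    refine .yt 0 m m (e 0) (e 0) (by simp [hr]) (by omega) (by omega) ?_
    have h1 : Reach (2 * (m + 1)) G₂ x y (e 0) m (2 * h + (h + 4)) i :=
      he x y m i (alive_last x) (by omega) (by omega) hi (by omega) (by have := hi.1; omega)
    simpa using h1.of_prefix (List.prefix_append G₂ [r])

end Search

/-! ### Directions -/

/-- The map `z ↦ (⟨a, z⟩, ⟨b, z⟩)` is linear and injective in finite dimension, hence bounded below
in the sup norm. -/
theorem exists_le_max_abs_inner {a b : Plane} (h : LinearIndependent ℝ ![a, b]) :
    ∃ c : ℝ, 0 < c ∧ ∀ z : Plane, c * ‖z‖ ≤ max |inner ℝ a z| |inner ℝ b z| := by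
  let f : Plane →L[ℝ] ℝ × ℝ := (innerSL ℝ a).prod (innerSL ℝ b)
  have hspan : Submodule.span ℝ (Set.range ![a, b]) = ⊤ :=
    h.span_eq_top_of_card_eq_finrank' (by simp)
  have hker : LinearMap.ker (f : Plane →ₗ[ℝ] ℝ × ℝ) = ⊥ := by
    rw [LinearMap.ker_eq_bot']
    intro z hz
    have h1 : inner ℝ a z = 0 ∧ inner ℝ b z = 0 := by simpa [f] using hz
    have hz' : ∀ y ∈ Submodule.span ℝ (Set.range ![a, b]), inner ℝ y z = 0 := by
      intro y hy
      induction hy using Submodule.span_induction with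
      | mem y hy =>
        obtain ⟨i, rfl⟩ := hy
        fin_cases i
        · exact h1.1
        · exact h1.2
      | zero => simp
      | add y y' _ _ h h' => rw [inner_add_left, h, h', add_zero]
      | smul r y _ h => rw [inner_smul_left, h, mul_zero]
    exact inner_self_eq_zero.mp (hz' z (by rw [hspan]; trivial))
  obtain ⟨K, hK, hf⟩ := LinearMap.exists_antilipschitzWith (f : Plane →ₗ[ℝ] ℝ × ℝ) hker
  refine ⟨(K : ℝ)⁻¹, by positivity, fun z => ?_⟩
  have h1 := hf.le_mul_dist z 0
  rw [map_zero, dist_zero_right, dist_zero_right] at h1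
  rw [inv_mul_le_iff₀ (by positivity)]
  exact h1

/-- The direction of a vector. -/
noncomputable def direction (z : Plane) : Plane := ‖z‖⁻¹ • z

theorem norm_smul_direction (z : Plane) : ‖z‖ • direction z = z := by
  unfold direction
  by_cases hz : z = 0
  · simp [hz]
  · rw [smul_smul, mul_inv_cancel₀ (norm_ne_zero_iff.mpr hz), one_smul]

theorem norm_direction {z : Plane} (hz : z ≠ 0) : ‖direction z‖ = 1 := by
  rw [direction, norm_smul, norm_inv, norm_norm, inv_mul_cancel₀ (norm_ne_zero_iff.mpr hz)]

/-- The unit circle is covered by finitely many balls of radius `δ / 2`; `χ` picks a ball containing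
the direction. -/
theorem exists_finite_directions {δ : ℝ} (hδ : 0 < δ) :
    ∃ (t : Finset Plane) (χ : Plane → Plane), (∀ z, z ≠ 0 → χ z ∈ t) ∧
      ∀ z z', z ≠ 0 → z' ≠ 0 → χ z = χ z' → ‖direction z' - direction z‖ ≤ δ := by
  obtain ⟨t, -, htf, ht⟩ :=
    (isCompact_sphere (0 : Plane) 1).finite_cover_balls (half_pos hδ)
  have h : ∀ z : Plane, ∃ p, z ≠ 0 → p ∈ t ∧ dist (direction z) p < δ / 2 := by
    intro z
    by_cases hz : z = 0
    · exact ⟨0, fun h => absurd hz h⟩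
    · have := ht (show direction z ∈ Metric.sphere (0 : Plane) 1 by simp [norm_direction hz])
      simp only [Set.mem_iUnion, Metric.mem_ball] at this
      obtain ⟨p, hp, hd⟩ := this
      exact ⟨p, fun _ => ⟨hp, hd⟩⟩
  choose χ hχ using h
  refine ⟨htf.toFinset, χ, fun z hz => by simpa using (hχ z hz).1, fun z z' hz hz' he => ?_⟩
  rw [← dist_eq_norm]
  have h1 := (hχ z hz).2
  have h2 := (hχ z' hz').2
  rw [he] at h1
  have := dist_triangle_right (direction z') (direction z) (χ z')
  linarith

/-- If `e` has nearly the direction of the longer vector `d` and is not longer than `d - e`, but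
has the larger value under `U`, then `U` is small in this direction. -/
theorem lt_of_similar_direction {U : Plane →L[ℝ] ℝ} {M δ : ℝ} (hM : ∀ z, |U z| ≤ M * ‖z‖)
    (hM0 : 0 ≤ M) (hδ : δ ≤ 1 / 2) {d e : Plane} (hd : d ≠ 0)
    (hde : ‖direction e - direction d‖ ≤ δ) (h1 : ‖e‖ ≤ ‖d‖) (h2 : ‖e‖ ≤ ‖d - e‖)
    (h3 : 0 ≤ U d) (h4 : U d < U e) : |U d| < 2 * M * δ * ‖d‖ := by
  set η := direction e - direction d with hη
  have hδ0 : 0 ≤ δ := (norm_nonneg _).trans hde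
  have hD : 0 < ‖d‖ := norm_pos_iff.mpr hd
  have hE : 0 ≤ ‖e‖ := norm_nonneg e
  have he : e = ‖e‖ • (direction d + η) := by
    rw [hη, add_sub_cancel, norm_smul_direction]
  have hdd : d = ‖d‖ • direction d := (norm_smul_direction d).symm
  have h5 : ‖d - e‖ ≤ (‖d‖ - ‖e‖) + ‖e‖ * δ := by
    have : d - e = (‖d‖ - ‖e‖) • direction d - ‖e‖ • η := by
      conv_lhs => rw [hdd, he]
      module
    rw [this]
    refine (norm_sub_le _ _).trans ?_
    rw [norm_smul, norm_smul, norm_direction hd, mul_one, Real.norm_of_nonneg (by linarith),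
      norm_norm]
    gcongr
  -- As `‖e‖ ≤ ‖d - e‖` and `δ ≤ 1 / 2`, the vector `e` is shorter than `d` by a constant factor. It
  -- can then exceed `d` under `U` only through the error `U η`.
  have h6 : 3 * ‖e‖ ≤ 2 * ‖d‖ := by nlinarith
  have hUη : U η ≤ M * δ :=
    (le_abs_self _).trans ((hM η).trans (by gcongr))
  have hUd : U d = ‖d‖ * U (direction d) := by
    conv_lhs => rw [hdd]
    simp
  have hUe : U e = ‖e‖ * (U (direction d) + U η) := by
    conv_lhs => rw [he]
    rw [map_smul, map_add, smul_eq_mul]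
  set s := U (direction d) with hs
  have hs0 : 0 ≤ s := by
    rw [hUd] at h3
    exact nonneg_of_mul_nonneg_right h3 hD
  have h7 : ‖d‖ * s < ‖e‖ * (s + M * δ) := by
    rw [← hUd]
    refine h4.trans_le ?_
    rw [hUe]
    gcongr
  have h8 : ‖e‖ * (s + M * δ) * 3 ≤ 2 * ‖d‖ * (s + M * δ) := by
    have : 0 ≤ s + M * δ := by positivity
    nlinarith
  have h9 : ‖d‖ * s < ‖d‖ * (2 * M * δ) := by nlinarith
  rw [abs_of_nonneg h3, hUd]
  linarith

/-! ### Counting pairs -/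

section Count

variable {U V : Plane →L[ℝ] ℝ} {c M δ : ℝ} {t : Finset Plane} {χ : Plane → Plane}

/-- Pairs `(a, b)` with `a` on the upper left of `b`, each a closest pair of the quadrant that it
spans, are linear in number. -/
theorem card_antichain_pairs_le (hc : ∀ z : Plane, c * ‖z‖ ≤ max |U z| |V z|)
    (hMU : ∀ z, |U z| ≤ M * ‖z‖) (hMV : ∀ z, |V z| ≤ M * ‖z‖) (hM0 : 0 ≤ M) (hδ : δ ≤ 1 / 2)
    (hδc : 2 * M * δ < c) (ht : ∀ z, z ≠ 0 → χ z ∈ t)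
    (hχ : ∀ z z', z ≠ 0 → z' ≠ 0 → χ z = χ z' → ‖direction z' - direction z‖ ≤ δ)
    (S : Finset Plane) (D : Finset (Plane × Plane))
    (hDS : ∀ p ∈ D, p.1 ∈ S ∧ p.2 ∈ S ∧ U p.1 < U p.2 ∧ V p.2 < V p.1)
    (hmin : ∀ p ∈ D, ∀ z ∈ S, ∀ z' ∈ S, z ≠ z' → U p.1 ≤ U z → U p.1 ≤ U z' → V p.2 ≤ V z →
      V p.2 ≤ V z' → dist p.1 p.2 ≤ dist z z')
    (huniq : ∀ p ∈ D, ∀ p' ∈ D, U p.1 = U p'.1 → V p.2 = V p'.2 → p = p') :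
    D.card ≤ 2 * t.card * S.card := by
  classical
  -- In each direction class, a pair is charged to its first point if no pair with that point has a
  -- lower partner, and to its second point otherwise.
  let bad : Plane × Plane → Prop := fun p =>
    ∃ b', (p.1, b') ∈ D ∧ χ (p.2 - p.1) = χ (b' - p.1) ∧ V b' < V p.2
  let f : Plane × Plane → Plane × Plane × Bool := fun p =>
    if bad p then (p.2, χ (p.2 - p.1), true) else (p.1, χ (p.2 - p.1), false)
  have hne : ∀ p ∈ D, p.2 - p.1 ≠ 0 := by
    intro p hp h
    have := (hDS p hp).2.2.1
    rw [sub_eq_zero.mp h] at this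
    exact lt_irrefl _ this
  -- Suppose `b'` is below `b` and `a'` is left of `a`. The quadrants spanned by `(a, b')` and `(a',
  -- b)` contain `a` and `b`, so minimality bounds `‖b' - a‖` and `‖b - a'‖`. Then `V` and `U` are
  -- both too small on `b - a` for `hc`.
  have hgood : ∀ p ∈ D, bad p → ∀ a', (a', p.2) ∈ D → χ (p.2 - p.1) = χ (p.2 - a') →
      ¬ U a' < U p.1 := by
    rintro ⟨a, b⟩ hp ⟨b', hb', hχb, hVb⟩ a' ha' hχa hUa
    simp only at hb' hχb hVb ha' hχa hUa
    obtain ⟨haS, hbS, hab1, hab2⟩ := hDS _ hp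
    obtain ⟨-, hbS', hb1, hb2⟩ := hDS _ hb'
    obtain ⟨haS', -, ha1, ha2⟩ := hDS _ ha'
    simp only at haS hbS hab1 hab2 hbS' hb1 hb2 haS' ha1 ha2
    have hd : b - a ≠ 0 := hne _ hp
    have hab : a ≠ b := fun h => hd (by rw [h, sub_self])
    have hbb : b ≠ b' := fun h => hVb.ne (by rw [h])
    have haa : a ≠ a' := fun h => hUa.ne (by rw [h])
    have e1 : dist a b' ≤ dist a b :=
      hmin _ hb' a haS b hbS hab le_rfl hab1.le hb2.le hVb.le
    have e2 : dist a b' ≤ dist b b' :=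
      hmin _ hb' b hbS b' hbS' hbb hab1.le hb1.le hVb.le le_rfl
    have f1 : dist a' b ≤ dist a b :=
      hmin _ ha' a haS b hbS hab hUa.le ha1.le hab2.le le_rfl
    have f2 : dist a' b ≤ dist a a' :=
      hmin _ ha' a haS a' haS' haa hUa.le le_rfl hab2.le ha2.le
    have hVd : |V (b - a)| < 2 * M * δ * ‖b - a‖ := by
      have := lt_of_similar_direction (U := -V) (d := b - a) (e := b' - a) (M := M) (δ := δ)
        (fun z => by simpa using hMV z) hM0 hδ hd (hχ _ _ hd (hne _ hb') hχb)
        (by rw [dist_comm a b', dist_comm a b] at e1; simpa [dist_eq_norm] using e1)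
        (by rw [dist_comm a b'] at e2; simpa [dist_eq_norm] using e2)
        (by simp only [neg_apply, map_sub]; linarith)
        (by simp only [neg_apply, map_sub]; linarith)
      simpa only [neg_apply, abs_neg] using this
    have hUd : |U (b - a)| < 2 * M * δ * ‖b - a‖ :=
      lt_of_similar_direction (d := b - a) (e := b - a') (M := M) (δ := δ)
        hMU hM0 hδ hd (hχ _ _ hd (hne _ ha') hχa)
        (by rw [dist_comm a' b, dist_comm a b] at f1; simpa [dist_eq_norm] using f1)
        (by
          rw [dist_comm a' b, dist_comm a a'] at f2
          rw [sub_sub_sub_cancel_left]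
          simpa [dist_eq_norm] using f2)
        (by simp only [map_sub]; linarith)
        (by simp only [map_sub]; linarith)
    have h1 := hc (b - a)
    have h2 := max_lt hUd hVd
    have h3 : 0 < ‖b - a‖ := norm_pos_iff.mpr hd
    nlinarith
  have hcard : (S ×ˢ t ×ˢ (Finset.univ : Finset Bool)).card = 2 * t.card * S.card := by
    simp only [Finset.card_product, Finset.card_univ, Fintype.card_bool]
    ring
  rw [← hcard]
  apply Finset.card_le_card_of_injOn f
  · intro p hp
    have h1 := hDS p hp
    have h2 := ht _ (hne p hp)
    simp only [f]
    split_ifs <;> simp [h1, h2]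
  · rintro ⟨a, b⟩ hp ⟨a', b'⟩ hp' hff
    simp only [f] at hff
    split_ifs at hff with hb hb' hb'
    · simp only [Prod.mk.injEq, and_true] at hff
      obtain ⟨rfl, hχe⟩ := hff
      have g1 := hgood _ hp hb a' hp' hχe
      have g2 := hgood _ hp' hb' a hp hχe.symm
      exact huniq _ hp _ hp' (le_antisymm (not_lt.mp g1) (not_lt.mp g2)) rfl
    · simp at hff
    · simp at hff
    · simp only [Prod.mk.injEq, and_true] at hff
      obtain ⟨rfl, hχe⟩ := hff
      have g1 : ¬ V b' < V b := fun h => hb ⟨b', hp', hχe, h⟩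
      have g2 : ¬ V b < V b' := fun h => hb' ⟨b, hp, hχe.symm, h⟩
      exact huniq _ hp _ hp' rfl (le_antisymm (not_lt.mp g1) (not_lt.mp g2))

/-- The pairs of points of `S` that come first, in the order given by `κ`, among the pairs in the
quadrant that they span. -/
noncomputable def candidates {β : Type*} [LinearOrder β] (U V : Plane → ℝ)
    (κ : Plane × Plane → β) (S : Finset Plane) : Finset (Plane × Plane) := by
  classical
  exact S.offDiag.filter fun p => ∀ p' ∈ S.offDiag,
    min (U p.1) (U p.2) ≤ min (U p'.1) (U p'.2) → min (V p.1) (V p.2) ≤ min (V p'.1) (V p'.2) →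
      κ p ≤ κ p'

/-- If one point is below the other in both coordinates, it is the corner of the quadrant, and the
corner determines the candidate. The other two arrangements are antichains, exchanged by swapping
`U` and `V`. -/
theorem card_candidates_le {β : Type*} [LinearOrder β]
    (hc : ∀ z : Plane, c * ‖z‖ ≤ max |U z| |V z|)
    (hMU : ∀ z, |U z| ≤ M * ‖z‖) (hMV : ∀ z, |V z| ≤ M * ‖z‖) (hM0 : 0 ≤ M) (hδ : δ ≤ 1 / 2)
    (hδc : 2 * M * δ < c) (ht : ∀ z, z ≠ 0 → χ z ∈ t)
    (hχ : ∀ z z', z ≠ 0 → z' ≠ 0 → χ z = χ z' → ‖direction z' - direction z‖ ≤ δ)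
    (S : Finset Plane) (κ : Plane × Plane → β) (hκ : Set.InjOn κ S.offDiag)
    (hκd : ∀ p p', κ p ≤ κ p' → dist p.1 p.2 ≤ dist p'.1 p'.2) :
    (candidates U V κ S).card ≤ (4 * t.card + 2) * S.card := by
  classical
  set C := candidates U V κ S with hC
  have hmem : ∀ p ∈ C, (p.1 ∈ S ∧ p.2 ∈ S ∧ p.1 ≠ p.2) ∧ ∀ p' ∈ S.offDiag,
      min (U p.1) (U p.2) ≤ min (U p'.1) (U p'.2) → min (V p.1) (V p.2) ≤ min (V p'.1) (V p'.2) →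
      κ p ≤ κ p' := by
    intro p hp
    rw [hC, candidates, Finset.mem_filter, Finset.mem_offDiag] at hp
    exact hp
  have hsame : ∀ p ∈ C, ∀ p' ∈ C, min (U p.1) (U p.2) = min (U p'.1) (U p'.2) →
      min (V p.1) (V p.2) = min (V p'.1) (V p'.2) → p = p' := by
    intro p hp p' hp' h1 h2
    have ho := Finset.mem_offDiag.mpr (hmem p hp).1
    have ho' := Finset.mem_offDiag.mpr (hmem p' hp').1
    exact hκ ho ho' (le_antisymm ((hmem p hp).2 p' ho' h1.le h2.le)
      ((hmem p' hp').2 p ho h1.ge h2.ge))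
  let C₁ := C.filter fun p => U p.1 ≤ U p.2 ∧ V p.1 ≤ V p.2
  let C₂ := C.filter fun p => U p.2 ≤ U p.1 ∧ V p.2 ≤ V p.1
  let A₁ := C.filter fun p => U p.1 < U p.2 ∧ V p.2 < V p.1
  let A₂ := C.filter fun p => U p.2 < U p.1 ∧ V p.1 < V p.2
  have hC₁ : C₁.card ≤ S.card := by
    apply Finset.card_le_card_of_injOn Prod.fst
    · intro p hp
      exact (hmem p (Finset.mem_filter.mp hp).1).1.1
    · intro p hp p' hp' h
      obtain ⟨hp, h1, h2⟩ := Finset.mem_filter.mp hp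
      obtain ⟨hp', h1', h2'⟩ := Finset.mem_filter.mp hp'
      apply hsame p hp p' hp'
      · rw [min_eq_left h1, min_eq_left h1', h]
      · rw [min_eq_left h2, min_eq_left h2', h]
  have hC₂ : C₂.card ≤ S.card := by
    apply Finset.card_le_card_of_injOn Prod.snd
    · intro p hp
      exact (hmem p (Finset.mem_filter.mp hp).1).1.2.1
    · intro p hp p' hp' h
      obtain ⟨hp, h1, h2⟩ := Finset.mem_filter.mp hp
      obtain ⟨hp', h1', h2'⟩ := Finset.mem_filter.mp hp'
      apply hsame p hp p' hp'
      · rw [min_eq_right h1, min_eq_right h1', h]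
      · rw [min_eq_right h2, min_eq_right h2', h]
  have hA₁ : A₁.card ≤ 2 * t.card * S.card := by
    apply card_antichain_pairs_le hc hMU hMV hM0 hδ hδc ht hχ S
    · intro p hp
      obtain ⟨hp, h⟩ := Finset.mem_filter.mp hp
      exact ⟨(hmem p hp).1.1, (hmem p hp).1.2.1, h⟩
    · intro p hp z hz z' hz' hne h1 h2 h3 h4
      obtain ⟨hp, h⟩ := Finset.mem_filter.mp hp
      refine hκd p (z, z') ((hmem p hp).2 _ (Finset.mem_offDiag.mpr ⟨hz, hz', hne⟩) ?_ ?_)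
      · rw [min_eq_left h.1.le]
        exact le_min h1 h2
      · rw [min_eq_right h.2.le]
        exact le_min h3 h4
    · intro p hp p' hp' h1 h2
      obtain ⟨hp, h⟩ := Finset.mem_filter.mp hp
      obtain ⟨hp', h'⟩ := Finset.mem_filter.mp hp'
      apply hsame p hp p' hp'
      · rw [min_eq_left h.1.le, min_eq_left h'.1.le, h1]
      · rw [min_eq_right h.2.le, min_eq_right h'.2.le, h2]
  have hA₂ : A₂.card ≤ 2 * t.card * S.card := by
    apply card_antichain_pairs_le (U := V) (V := U) (fun z => by rw [max_comm]; exact hc z) hMV hMU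
      hM0 hδ hδc ht hχ S
    · intro p hp
      obtain ⟨hp, h⟩ := Finset.mem_filter.mp hp
      exact ⟨(hmem p hp).1.1, (hmem p hp).1.2.1, h.symm⟩
    · intro p hp z hz z' hz' hne h1 h2 h3 h4
      obtain ⟨hp, h⟩ := Finset.mem_filter.mp hp
      refine hκd p (z, z') ((hmem p hp).2 _ (Finset.mem_offDiag.mpr ⟨hz, hz', hne⟩) ?_ ?_)
      · rw [min_eq_right h.1.le]
        exact le_min h3 h4
      · rw [min_eq_left h.2.le]
        exact le_min h1 h2
    · intro p hp p' hp' h1 h2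
      obtain ⟨hp, h⟩ := Finset.mem_filter.mp hp
      obtain ⟨hp', h'⟩ := Finset.mem_filter.mp hp'
      apply hsame p hp p' hp'
      · rw [min_eq_right h.1.le, min_eq_right h'.1.le, h2]
      · rw [min_eq_left h.2.le, min_eq_left h'.2.le, h1]
  have hcover : C ⊆ (C₁ ∪ C₂) ∪ (A₁ ∪ A₂) := by
    intro p hp
    simp only [C₁, C₂, A₁, A₂, Finset.mem_union, Finset.mem_filter, hp, true_and]
    rcases le_or_gt (U p.1) (U p.2) with h1 | h1 <;> rcases le_or_gt (V p.1) (V p.2) with h2 | h2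
    · exact Or.inl (Or.inl ⟨h1, h2⟩)
    · rcases h1.eq_or_lt with h3 | h3
      · exact Or.inl (Or.inr ⟨h3.ge, h2.le⟩)
      · exact Or.inr (Or.inl ⟨h3, h2⟩)
    · rcases h2.eq_or_lt with h3 | h3
      · exact Or.inl (Or.inr ⟨h1.le, h3.ge⟩)
      · exact Or.inr (Or.inr ⟨h1, h3⟩)
    · exact Or.inl (Or.inr ⟨h1.le, h2.le⟩)
  calc C.card ≤ ((C₁ ∪ C₂) ∪ (A₁ ∪ A₂)).card := Finset.card_le_card hcover
    _ ≤ (C₁.card + C₂.card) + (A₁.card + A₂.card) :=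
        (Finset.card_union_le _ _).trans
          (add_le_add (Finset.card_union_le _ _) (Finset.card_union_le _ _))
    _ ≤ (S.card + S.card) + (2 * t.card * S.card + 2 * t.card * S.card) := by gcongr
    _ = (4 * t.card + 2) * S.card := by ring

end Count

/-! ### The candidate pairs answer all queries -/

theorem exists_enumeration {α β : Type*} [LinearOrder β] (C : Finset α) (κ : α → β)
    (a₀ : α) : ∃ g : ℕ → α, ∃ m ≤ C.card, (∀ i < m, g i ∈ C) ∧
      (∀ e ∈ C, ∃ i < m, κ (g i) = κ e) ∧ ∀ i j, i ≤ j → j < m → κ (g i) ≤ κ (g j) := by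
  classical
  let T := C.image κ
  have h : ∀ i : ℕ, ∃ e, ∀ hi : i < T.card, e ∈ C ∧ κ e = T.orderEmbOfFin rfl ⟨i, hi⟩ := by
    intro i
    by_cases hi : i < T.card
    · obtain ⟨e, he, hk⟩ := Finset.mem_image.mp (T.orderEmbOfFin_mem rfl ⟨i, hi⟩)
      exact ⟨e, fun _ => ⟨he, hk⟩⟩
    · exact ⟨a₀, fun h => absurd h hi⟩
  choose g hg using h
  refine ⟨g, T.card, Finset.card_image_le, fun i hi => (hg i hi).1, fun e he => ?_,
    fun i j hij hj => ?_⟩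
  · have : κ e ∈ Set.range (T.orderEmbOfFin rfl) := by
      rw [Finset.range_orderEmbOfFin]
      exact Finset.mem_image_of_mem κ he
    obtain ⟨⟨i, hi⟩, hie⟩ := this
    exact ⟨i, hi, (hg i hi).2.trans hie⟩
  · rw [(hg i (hij.trans_lt hj)).2, (hg j hj).2]
    exact (T.orderEmbOfFin rfl).monotone hij

/-- Linearly many pairs, sorted by distance, suffice to answer all closest-pair queries for the
translates of a wedge. -/
theorem exists_candidate_sequence {a b : Plane} (h : LinearIndependent ℝ ![a, b]) :
    ∃ A : ℕ, ∀ S : Finset Plane, ∃ (m : ℕ) (P Q : ℕ → Plane), m ≤ A * S.card ∧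
      ∀ x y i, IsFirst m (fun i => min (inner ℝ a (P i)) (inner ℝ a (Q i)))
        (fun i => min (inner ℝ b (P i)) (inner ℝ b (Q i))) x y i →
        (i < m ∧ IsClosestPair {z | z ∈ S ∧ x ≤ inner ℝ a z ∧ y ≤ inner ℝ b z} (P i) (Q i)) ∨
        (i = m ∧ {z | z ∈ S ∧ x ≤ inner ℝ a z ∧ y ≤ inner ℝ b z}.Subsingleton) := by
  classical
  obtain ⟨c, hc0, hc⟩ := exists_le_max_abs_inner h
  set M := max ‖a‖ ‖b‖ with hM
  have hM0 : 0 ≤ M := (norm_nonneg a).trans (le_max_left _ _)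
  have hδ : ∃ δ : ℝ, 0 < δ ∧ δ ≤ 1 / 2 ∧ 2 * M * δ < c := by
    refine ⟨min (1 / 2) (c / (2 * M + 1)), by positivity, min_le_left _ _, ?_⟩
    have h1 : min (1 / 2) (c / (2 * M + 1)) ≤ c / (2 * M + 1) := min_le_right _ _
    calc 2 * M * min (1 / 2) (c / (2 * M + 1)) ≤ 2 * M * (c / (2 * M + 1)) := by gcongr
      _ < (2 * M + 1) * (c / (2 * M + 1)) := by
        have : 0 < c / (2 * M + 1) := by positivity
        nlinarith
      _ = c := by field_simp
  obtain ⟨δ, hδ0, hδ, hδc⟩ := hδ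
  obtain ⟨t, χ, ht, hχ⟩ := exists_finite_directions hδ0
  refine ⟨4 * t.card + 2, fun S => ?_⟩
  obtain ⟨idx, hidx⟩ := Set.countable_iff_exists_injOn.mp S.offDiag.countable_toSet
  -- The injective index breaks ties, including that between a pair and its reversal, so each corner
  -- belongs to at most one candidate.
  let κ : Plane × Plane → ℝ ×ₗ ℕ := fun p => toLex (dist p.1 p.2, idx p)
  have hκ : Set.InjOn κ S.offDiag := fun p hp p' hp' he => by
    have : (dist p.1 p.2, idx p) = (dist p'.1 p'.2, idx p') := toLex.injective he
    exact hidx hp hp' (Prod.mk.inj this).2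
  have hκd : ∀ p p', κ p ≤ κ p' → dist p.1 p.2 ≤ dist p'.1 p'.2 := fun p p' hle => by
    rcases Prod.Lex.toLex_le_toLex.mp hle with h1 | h1
    · exact h1.le
    · exact h1.1.le
  let U : Plane →L[ℝ] ℝ := innerSL ℝ a
  let V : Plane →L[ℝ] ℝ := innerSL ℝ b
  set C := candidates U V κ S with hC
  have hcard : C.card ≤ (4 * t.card + 2) * S.card :=
    card_candidates_le (U := U) (V := V) (c := c) (M := M) (δ := δ) hc
      (fun z => (abs_real_inner_le_norm a z).trans (by gcongr; exact le_max_left _ _))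
      (fun z => (abs_real_inner_le_norm b z).trans (by gcongr; exact le_max_right _ _))
      hM0 hδ hδc ht hχ S κ hκ hκd
  obtain ⟨g, m, hm, hgC, hgs, hgm⟩ := exists_enumeration C κ (0, 0)
  refine ⟨m, fun i => (g i).1, fun i => (g i).2, hm.trans hcard, fun x y i hi => ?_⟩
  have hCmem : ∀ p, p ∈ C ↔ p ∈ S.offDiag ∧ ∀ p' ∈ S.offDiag,
      min (U p.1) (U p.2) ≤ min (U p'.1) (U p'.2) → min (V p.1) (V p.2) ≤ min (V p'.1) (V p'.2) →
      κ p ≤ κ p' := fun p => by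
    rw [hC, candidates, Finset.mem_filter]
  -- The `κ`-least pair in the query quadrant is a candidate, because the quadrant that it spans is
  -- contained in the query quadrant.
  have hfirst : ∀ z z', z ∈ S → z' ∈ S → z ≠ z' → x ≤ U z → x ≤ U z' → y ≤ V z → y ≤ V z' →
      ∃ i' < m, x ≤ min (U (g i').1) (U (g i').2) ∧ y ≤ min (V (g i').1) (V (g i').2) ∧
        κ (g i') ≤ κ (z, z') := by
    intro z z' hz hz' hne h1 h2 h3 h4
    let T := S.offDiag.filter fun p =>
      x ≤ min (U p.1) (U p.2) ∧ y ≤ min (V p.1) (V p.2)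
    have hzT : (z, z') ∈ T := Finset.mem_filter.mpr
      ⟨Finset.mem_offDiag.mpr ⟨hz, hz', hne⟩, le_min h1 h2, le_min h3 h4⟩
    obtain ⟨e, heT, hemin⟩ := T.exists_min_image κ ⟨_, hzT⟩
    obtain ⟨heS, hex, hey⟩ := Finset.mem_filter.mp heT
    have heC : e ∈ C := (hCmem e).mpr ⟨heS, fun p' hp' h5 h6 =>
      hemin p' (Finset.mem_filter.mpr ⟨hp', hex.trans h5, hey.trans h6⟩)⟩
    obtain ⟨i', hi', hge⟩ := hgs e heC
    have : g i' = e := hκ ((hCmem _).mp (hgC i' hi')).1 heS hge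
    exact ⟨i', hi', by rwa [this], by rwa [this], by rw [this]; exact hemin _ hzT⟩
  rcases hi.1.lt_or_eq with hlt | heq
  · left
    refine ⟨hlt, ?_⟩
    obtain ⟨hx, hy⟩ := hi.2.1 hlt
    obtain ⟨hx1, hx2⟩ := le_min_iff.mp hx
    obtain ⟨hy1, hy2⟩ := le_min_iff.mp hy
    obtain ⟨s1, s2, s3⟩ := Finset.mem_offDiag.mp ((hCmem _).mp (hgC i hlt)).1
    refine ⟨⟨s1, hx1, hy1⟩, ⟨s2, hx2, hy2⟩, s3, ?_⟩
    rintro z ⟨hz, hzx, hzy⟩ z' ⟨hz', hzx', hzy'⟩ hne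
    obtain ⟨i', hi', h1, h2, h3⟩ := hfirst z z' hz hz' hne hzx hzx' hzy hzy'
    have hii : i ≤ i' := by
      by_contra hii
      exact hi.2.2 i' (not_le.mp hii) ⟨h1, h2⟩
    exact hκd (g i) (z, z') ((hgm i i' hii hi').trans h3)
  · right
    refine ⟨heq, ?_⟩
    rintro z ⟨hz, hzx, hzy⟩ z' ⟨hz', hzx', hzy'⟩
    by_contra hne
    obtain ⟨i', hi', h1, h2, -⟩ := hfirst z z' hz hz' hne hzx hzx' hzy hzy'
    exact hi.2.2 i' (by omega) ⟨h1, h2⟩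

open RealRAM

/-! ### The query program -/

/-- Evaluates the two linear functionals at the query point, and then interprets the records.
Integer register `1` holds the address of the current record, `2` the constant `1`, `3` the marker;
real registers `4` and `5` hold the transformed query point. -/
noncomputable def queryProgram (a b : Plane) (α β : ℝ) : Program :=
  [.rconst 4 (a 0), .rmul 4 4 0, .rconst 5 (a 1), .rmul 5 5 1, .radd 4 4 5, .rconst 5 α,
    .radd 4 4 5, .rconst 5 (b 0), .rmul 5 5 0, .rconst 6 (b 1), .rmul 6 6 1, .radd 5 5 6,
    -- Integer register `10` is never written and holds `0`, the cell with the starting address.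
    .rconst 6 β, .radd 5 5 6, .iconst 2 1, .iload 1 10,
    .icopy 4 1, .iload 5 4, .iadd 4 4 2, .iload 6 4, .iadd 4 4 2, .iload 7 4, .iadd 4 4 2,
    .iload 8 4, .iadd 4 4 2, .iload 9 4, .rload 6 1,
    .jumpIfILt 5 2 41, .isub 5 5 2, .jumpIfILt 5 2 46, .isub 5 5 2, .jumpIfILt 5 2 51,
    .icopy 0 6, .rload 0 1, .iadd 1 1 2, .rload 1 1, .iadd 1 1 2, .rload 2 1, .iadd 1 1 2,
    .rload 3 1, .halt,
    -- The tests of the three comparison records start at `41`, `46` and `51`; they share the exits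
    -- `42` and `44`, which follow the first or the second address.
    .jumpIfRLt 6 4 44, .icopy 1 6, .jump 16, .icopy 1 7, .jump 16,
    .jumpIfRLt 6 5 49, .icopy 3 8, .jump 42, .icopy 3 9, .jump 44,
    .jumpIfILt 3 8 42, .jump 44]

/-- The memory address of the record at position `p` of a list of length `n`. -/
def address (n p : ℕ) : ℕ := if p < n then 5 * p + 1 else 0

/-- The integer fields of a record: type, two addresses or a flag, and two markers. -/
def intField (n K m : ℕ) : Rec → ℕ → ℕ
  | .xt _ a b, f => if f = 0 then 0 else if f = 1 then address n a else if f = 2 then address n b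
      else 0
  | .yt _ j k a b, f => if f = 0 then 1 else if f = 1 then address n a else if f = 2 then
      address n b else if f = 3 then min j K else min k K
  | .wt mid a b, f => if f = 0 then 2 else if f = 1 then address n a else if f = 2 then
      address n b else if f = 3 then min mid K else 0
  | .found i, f => if f = 0 then 3 else if f = 1 then (if i < m then 1 else 0) else 0

/-- The real fields of a record: a threshold, or the coordinates of two points. -/
noncomputable def realField (P Q : ℕ → Plane) : Rec → ℕ → ℝ
  | .xt c _ _, _ => c
  | .yt c _ _ _ _, _ => c
  | .wt _ _ _, _ => 0
  | .found i, f => if f = 0 then P i 0 else if f = 1 then P i 1 else if f = 2 then Q i 0 else Q i 1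

/-- The memory that stores the records `G`, with the search starting at position `s`. -/
noncomputable def storedMemory (K m : ℕ) (P Q : ℕ → Plane) (G : List Rec) (s : ℕ) : Memory where
  ints := (List.range (5 * G.length + 1)).map fun A =>
    -- Record `p` occupies the cells `5 * p + 1` to `5 * p + 5` of both memories, so one address
    -- serves its integers and its reals.
    if A = 0 then address G.length s
    else intField G.length K m (G.getD ((A - 1) / 5) (.found 0)) ((A - 1) % 5)
  reals := (List.range (5 * G.length + 1)).map fun A =>
    realField P Q (G.getD ((A - 1) / 5) (.found 0)) ((A - 1) % 5)

/-! ### Contents and word size of the stored memory -/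

section Stored

variable {K m : ℕ} {P Q : ℕ → Plane} {G : List Rec} {s : ℕ}

theorem size_storedMemory : (storedMemory K m P Q G s).size = 10 * G.length + 2 := by
  simp only [storedMemory, Memory.size, List.length_map, List.length_range]
  omega

theorem address_le (n p : ℕ) : address n p ≤ 5 * n := by
  unfold address
  split_ifs <;> omega

theorem intField_le (n K m : ℕ) (r : Rec) (f : ℕ) : intField n K m r f ≤ 5 * n + K + 3 := by
  have h := address_le n
  cases r with
  | xt c a b => have := h a; have := h b; simp only [intField]; split_ifs <;> omega
  | yt c j k a b => have := h a; have := h b; simp only [intField]; split_ifs <;> omega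
  | wt mid a b => have := h a; have := h b; simp only [intField]; split_ifs <;> omega
  | found i => simp only [intField]; split_ifs <;> omega

theorem ints_storedMemory_le : ∀ x ∈ (storedMemory K m P Q G s).ints,
    x ≤ 5 * G.length + K + 3 := by
  intro x hx
  simp only [storedMemory, List.mem_map] at hx
  obtain ⟨A, -, rfl⟩ := hx
  split_ifs
  · exact (address_le _ _).trans (by omega)
  · exact intField_le _ _ _ _ _

theorem getElem?_ints_zero : (storedMemory K m P Q G s).ints[0]? = some (address G.length s) := by
  simp [storedMemory]

theorem getElem?_ints {p : ℕ} {r : Rec} (hp : G[p]? = some r) (f : ℕ) (hf : f < 5) :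
    (storedMemory K m P Q G s).ints[5 * p + 1 + f]? = some (intField G.length K m r f) := by
  obtain ⟨hlt, h2⟩ := List.getElem?_eq_some_iff.mp hp
  have h3 : 5 * p + 1 + f < 5 * G.length + 1 := by omega
  have h4 : (5 * p + 1 + f - 1) / 5 = p := by omega
  have h5 : (5 * p + 1 + f - 1) % 5 = f := by omega
  have h6 : 5 * p + 1 + f ≠ 0 := by omega
  simp only [storedMemory, List.getElem?_map, List.getElem?_range h3, Option.map_some, h4, h5,
    if_neg h6, List.getD_eq_getElem?_getD, hp, Option.getD_some]

theorem getElem?_reals {p : ℕ} {r : Rec} (hp : G[p]? = some r) (f : ℕ) (hf : f < 5) :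
    (storedMemory K m P Q G s).reals[5 * p + 1 + f]? = some (realField P Q r f) := by
  obtain ⟨hlt, h2⟩ := List.getElem?_eq_some_iff.mp hp
  have h3 : 5 * p + 1 + f < 5 * G.length + 1 := by omega
  have h4 : (5 * p + 1 + f - 1) / 5 = p := by omega
  have h5 : (5 * p + 1 + f - 1) % 5 = f := by omega
  simp only [storedMemory, List.getElem?_map, List.getElem?_range h3, Option.map_some, h4, h5,
    List.getD_eq_getElem?_getD, hp, Option.getD_some]

end Stored

/-- `Steps B P n c c'`: the program leads from `c` to `c'` in `n` steps. -/
inductive Steps (B : ℕ) (P : Program) : ℕ → Config → Config → Prop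
  | refl (c : Config) : Steps B P 0 c c
  | cons {n : ℕ} {c c' c'' : Config} :
      RealRAM.step B P c = some c' → Steps B P n c' c'' → Steps B P (n + 1) c c''

theorem Steps.exec {B : ℕ} {P : Program} {n : ℕ} {c c' : Config} (h : Steps B P n c c') :
    ∀ {τ : ℕ} {c'' : Config}, Exec B P c' τ c'' → Exec B P c (τ + n) c'' := by
  induction h with
  | refl c => exact fun h => h
  | cons h1 _ ih => exact fun h => Exec.step _ _ _ _ h1 (ih h)

/-- The configuration is about to process the record at address `p`. -/
structure AtRecord (M : Memory) (x y : ℝ) (p w : ℕ) (c : Config) : Prop where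
  pc : c.pc = 16
  pos : c.ireg 1 = p
  one : c.ireg 2 = 1
  marker : c.ireg 3 = w
  fst : c.rreg 4 = x
  snd : c.rreg 5 = y
  mem : c.mem = M

/-- The configuration has fetched the record with integer fields `f` and threshold `t`. -/
structure Fetched (M : Memory) (x y : ℝ) (p w : ℕ) (f : ℕ → ℕ) (t : ℝ) (c : Config) : Prop where
  pc : c.pc = 27
  pos : c.ireg 1 = p
  one : c.ireg 2 = 1
  marker : c.ireg 3 = w
  field : c.ireg 5 = f 0 ∧ c.ireg 6 = f 1 ∧ c.ireg 7 = f 2 ∧ c.ireg 8 = f 3 ∧ c.ireg 9 = f 4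
  fst : c.rreg 4 = x
  snd : c.rreg 5 = y
  thr : c.rreg 6 = t
  mem : c.mem = M

/-! ### Symbolic execution of the query program -/

section Run

variable {a b : Plane} {α β : ℝ} {B : ℕ} {M : Memory} {x y : ℝ} {p w : ℕ}

theorem AtRecord.fetch {c : Config} (hc : AtRecord M x y p w c) {f : ℕ → ℕ} {t : ℝ}
    (hf : ∀ i < 5, M.ints[p + i]? = some (f i)) (ht : M.reals[p]? = some t) (hB : p + 4 < B) :
    ∃ c', Steps B (queryProgram a b α β) 11 c c' ∧ Fetched M x y p w f t c' := by
  obtain ⟨pc, ireg, rreg, mem⟩ := c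
  obtain ⟨h1, h2, h3, h4, h5, h6, h7⟩ := hc
  dsimp only at h1 h2 h3 h4 h5 h6 h7
  subst h1 h7
  have f0 := hf 0 (by norm_num)
  have f1 := hf 1 (by norm_num)
  have f2 := hf 2 (by norm_num)
  have f3 := hf 3 (by norm_num)
  have f4 := hf 4 (by norm_num)
  rw [add_zero] at f0
  have b1 : p + 1 < B := by omega
  have b2 : p + 1 + 1 < B := by omega
  have b3 : p + 1 + 1 + 1 < B := by omega
  have b4 : p + 1 + 1 + 1 + 1 < B := by omega
  refine ⟨?_, ?_, ?_⟩
  -- The final configuration is left open and is determined by executing the instructions.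
  rotate_left
  · iterate 11
      refine Steps.cons (by
        simp [step, queryProgram, Config.setI, Config.setR, Function.update, h2, h3, f0, f1, f2,
          f3, f4, ht, b1, b2, b3, b4, add_assoc]
        rfl) ?_
    exact Steps.refl _
  · constructor <;> simp [Function.update, *]

theorem Fetched.run_xt {c : Config} {f : ℕ → ℕ} {t : ℝ} (hc : Fetched M x y p w f t c)
    (h : f 0 = 0) :
    ∃ n ≤ 9, ∃ c', Steps B (queryProgram a b α β) n c c' ∧
      AtRecord M x y (if x ≤ t then f 1 else f 2) w c' := by
  obtain ⟨pc, ireg, rreg, mem⟩ := c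
  obtain ⟨h1, h2, h3, h4, ⟨f0, f1, f2, f3, f4⟩, h5, h6, h7, h8⟩ := hc
  dsimp only at *
  subst h1 h8
  rw [h] at f0
  refine ⟨4, by norm_num, ?_⟩
  by_cases hx : x ≤ t
  · have hx' : ¬ t < x := not_lt.mpr hx
    refine ⟨?_, ?_, ?_⟩
    rotate_left
    · iterate 4
        refine Steps.cons (by
          simp [step, queryProgram, Config.setI, f0, h3, h5, h7, hx']
          rfl) ?_
      exact Steps.refl _
    · constructor <;> simp [Function.update, *]
  · have hx' : t < x := not_le.mp hx
    refine ⟨?_, ?_, ?_⟩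
    rotate_left
    · iterate 4
        refine Steps.cons (by
          simp [step, queryProgram, Config.setI, f0, h3, h5, h7, hx']
          rfl) ?_
      exact Steps.refl _
    · constructor <;> simp [Function.update, *]

theorem Fetched.run_yt {c : Config} {f : ℕ → ℕ} {t : ℝ} (hc : Fetched M x y p w f t c)
    (h : f 0 = 1) :
    ∃ n ≤ 9, ∃ c', Steps B (queryProgram a b α β) n c c' ∧
      AtRecord M x y (if y ≤ t then f 1 else f 2) (if y ≤ t then f 3 else f 4) c' := by
  obtain ⟨pc, ireg, rreg, mem⟩ := c
  obtain ⟨h1, h2, h3, h4, ⟨f0, f1, f2, f3, f4⟩, h5, h6, h7, h8⟩ := hc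
  dsimp only at *
  subst h1 h8
  rw [h] at f0
  refine ⟨8, by norm_num, ?_⟩
  by_cases hy : y ≤ t
  · have hy' : ¬ t < y := not_lt.mpr hy
    refine ⟨?_, ?_, ?_⟩
    rotate_left
    · iterate 8
        refine Steps.cons (by
          simp [step, queryProgram, Config.setI, Function.update, f0, h3, h6, h7, hy']
          rfl) ?_
      exact Steps.refl _
    · constructor <;> simp [Function.update, *]
  · have hy' : t < y := not_le.mp hy
    refine ⟨?_, ?_, ?_⟩
    rotate_left
    · iterate 8
        refine Steps.cons (by
          simp [step, queryProgram, Config.setI, Function.update, f0, h3, h6, h7, hy']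
          rfl) ?_
      exact Steps.refl _
    · constructor <;> simp [Function.update, *]

theorem Fetched.run_wt {c : Config} {f : ℕ → ℕ} {t : ℝ} (hc : Fetched M x y p w f t c)
    (h : f 0 = 2) :
    ∃ n ≤ 9, ∃ c', Steps B (queryProgram a b α β) n c c' ∧
      AtRecord M x y (if w < f 3 then f 1 else f 2) w c' := by
  obtain ⟨pc, ireg, rreg, mem⟩ := c
  obtain ⟨h1, h2, h3, h4, ⟨f0, f1, f2, f3, f4⟩, h5, h6, h7, h8⟩ := hc
  dsimp only at *
  subst h1 h8
  rw [h] at f0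
  by_cases hw : w < f 3
  · refine ⟨8, by norm_num, ?_, ?_, ?_⟩
    rotate_left
    · iterate 8
        refine Steps.cons (by
          simp [step, queryProgram, Config.setI, Function.update, f0, h3, h4, f3, hw]
          rfl) ?_
      exact Steps.refl _
    · constructor <;> simp [Function.update, *]
  · refine ⟨9, by norm_num, ?_, ?_, ?_⟩
    rotate_left
    · iterate 9
        refine Steps.cons (by
          simp [step, queryProgram, Config.setI, Function.update, f0, h3, h4, f3, hw]
          rfl) ?_
      exact Steps.refl _
    · constructor <;> simp [Function.update, *]

theorem Fetched.run_found {c : Config} {f : ℕ → ℕ} {t : ℝ} (hc : Fetched M x y p w f t c)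
    (h : f 0 = 3) {g : ℕ → ℝ} (hg : ∀ i < 5, M.reals[p + i]? = some (g i)) (hB : p + 4 < B) :
    ∃ c', Exec B (queryProgram a b α β) c 13 c' ∧ c'.ireg 0 = f 1 ∧
      c'.rreg 0 = g 0 ∧ c'.rreg 1 = g 1 ∧ c'.rreg 2 = g 2 ∧ c'.rreg 3 = g 3 := by
  obtain ⟨pc, ireg, rreg, mem⟩ := c
  obtain ⟨h1, h2, h3, h4, ⟨f0, f1, f2, f3, f4⟩, h5, h6, h7, h8⟩ := hc
  dsimp only at *
  subst h1 h8
  rw [h] at f0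
  have g0 := hg 0 (by norm_num)
  have g1 := hg 1 (by norm_num)
  have g2 := hg 2 (by norm_num)
  have g3 := hg 3 (by norm_num)
  rw [add_zero] at g0
  have b1 : p + 1 < B := by omega
  have b2 : p + 1 + 1 < B := by omega
  have b3 : p + 1 + 1 + 1 < B := by omega
  have key : ∃ c', Steps B (queryProgram a b α β) 13 ⟨27, ireg, rreg, mem⟩ c' ∧ c'.pc = 40 ∧
      c'.ireg 0 = f 1 ∧
      c'.rreg 0 = g 0 ∧ c'.rreg 1 = g 1 ∧ c'.rreg 2 = g 2 ∧ c'.rreg 3 = g 3 := by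
    refine ⟨?_, ?_, ?_⟩
    rotate_left
    · iterate 13
        refine Steps.cons (by
          simp [step, queryProgram, Config.setI, Config.setR, Function.update, f0, h2, h3, g0, g1,
            g2, g3, b1, b2, b3, add_assoc]
          rfl) ?_
      exact Steps.refl _
    · refine ⟨?_, ?_, ?_, ?_, ?_, ?_⟩ <;> simp [Function.update, *]
  obtain ⟨c', hs, hpc, hrest⟩ := key
  exact ⟨c', hs.exec (Exec.halt c' (by rw [hpc]; simp [queryProgram])), hrest⟩

theorem steps_prologue (q : Plane) (M : Memory) (hB : 1 < B) (hM : M.ints[0]? = some p) :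
    ∃ c, Steps B (queryProgram a b α β) 16 (queryConfig M q) c ∧
      AtRecord M (inner ℝ a q + α) (inner ℝ b q + β) p 0 c := by
  refine ⟨?_, ?_, ?_⟩
  rotate_left
  · unfold queryConfig
    iterate 16
      refine Steps.cons (by
        simp [step, queryProgram, Config.setI, Config.setR, Function.update, hB, hM]
        rfl) ?_
    exact Steps.refl _
  · constructor <;> simp [Function.update, PiLp.inner_apply, Fin.sum_univ_two] <;> ring

end Run

/-- The program carries out the search that is stored in the memory. -/
theorem Reach.exec {a b : Plane} {α β : ℝ} {B K m : ℕ} {P Q : ℕ → Plane} {G : List Rec} {s : ℕ}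
    {x y : ℝ} {p w d i : ℕ} (h : Reach K G x y p w d i) (hB : 5 * G.length + 5 < B) :
    ∀ c, AtRecord (storedMemory K m P Q G s) x y (address G.length p) w c →
      ∃ τ c', τ ≤ 20 * d + 24 ∧ Exec B (queryProgram a b α β) c τ c' ∧
        c'.ireg 0 = (if i < m then 1 else 0) ∧
        c'.rreg 0 = P i 0 ∧ c'.rreg 1 = P i 1 ∧ c'.rreg 2 = Q i 0 ∧ c'.rreg 3 = Q i 1 := by
  have haddr : ∀ {p : ℕ} {r : Rec}, G[p]? = some r → address G.length p = 5 * p + 1 := by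
    intro p r hp
    rw [address, if_pos (List.getElem?_eq_some_iff.mp hp).1]
  have hbound : ∀ {p : ℕ} {r : Rec}, G[p]? = some r → 5 * p + 1 + 4 < B := by
    intro p r hp
    have := (List.getElem?_eq_some_iff.mp hp).1
    omega
  have hfetch : ∀ {p w : ℕ} {r : Rec} {c : Config}, G[p]? = some r →
      AtRecord (storedMemory K m P Q G s) x y (address G.length p) w c →
      ∃ c', Steps B (queryProgram a b α β) 11 c c' ∧
        Fetched (storedMemory K m P Q G s) x y (5 * p + 1) w (intField G.length K m r)
          (realField P Q r 0) c' := by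
    intro p w r c hp hc
    rw [haddr hp] at hc
    exact hc.fetch (fun i hi => getElem?_ints hp i hi) (getElem?_reals hp 0 (by norm_num))
      (hbound hp)
  induction h with
  | @found p w d i hp =>
    intro c hc
    obtain ⟨c₁, hs, hf⟩ := hfetch hp hc
    obtain ⟨c', he, h0, h1, h2, h3, h4⟩ := hf.run_found rfl
      (fun i hi => getElem?_reals hp i hi) (hbound hp)
    exact ⟨_, c', by omega, hs.exec he, h0, h1, h2, h3, h4⟩
  | @xt p w d i t j k hp _ ih =>
    intro c hc
    obtain ⟨c₁, hs, hf⟩ := hfetch hp hc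
    obtain ⟨n, hn, c₂, hs₂, hc₂⟩ := hf.run_xt rfl
    obtain ⟨τ, c', hτ, he, hrest⟩ := ih c₂ (by
      convert hc₂ using 1
      simp only [intField, realField]
      split_ifs <;> simp_all)
    exact ⟨_, c', by omega, hs.exec (hs₂.exec he), hrest⟩
  | @yt p w d i t j k a b hp hj hk _ ih =>
    intro c hc
    obtain ⟨c₁, hs, hf⟩ := hfetch hp hc
    obtain ⟨n, hn, c₂, hs₂, hc₂⟩ := hf.run_yt rfl
    obtain ⟨τ, c', hτ, he, hrest⟩ := ih c₂ (by
      convert hc₂ using 1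
      · simp only [intField, realField]
        split_ifs <;> simp_all
      · simp only [intField, realField]
        split_ifs <;> simp_all)
    exact ⟨_, c', by omega, hs.exec (hs₂.exec he), hrest⟩
  | @wt p w d i mid a b hp hm _ ih =>
    intro c hc
    obtain ⟨c₁, hs, hf⟩ := hfetch hp hc
    obtain ⟨n, hn, c₂, hs₂, hc₂⟩ := hf.run_wt rfl
    -- Markers are cut off at `K` to bound the words; those met by a search are at most `K`, so
    -- nothing changes.
    have hmid : intField G.length K m (.wt mid a b) 3 = mid := by simp [intField, hm]
    rw [hmid] at hc₂
    obtain ⟨τ, c', hτ, he, hrest⟩ := ih c₂ (by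
      convert hc₂ using 1
      simp only [intField]
      split_ifs <;> simp_all)
    exact ⟨_, c', by omega, hs.exec (hs₂.exec he), hrest⟩

/-! ### The data structure -/

theorem inter_translateOf_wedge (S : Finset Plane) (a b : Plane) (α β : ℝ) (q : Plane) :
    (S : Set Plane) ∩ translateOf {x : Plane | α ≤ inner ℝ a x ∧ β ≤ inner ℝ b x} q =
      {z | z ∈ S ∧ inner ℝ a q + α ≤ inner ℝ a z ∧ inner ℝ b q + β ≤ inner ℝ b z} := by
  ext z
  simp only [translateOf, Set.mem_inter_iff, Finset.mem_coe, Set.mem_image, Set.mem_ofPred_eq]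
  refine and_congr_right fun _ => ⟨?_, fun h => ⟨z - q, ?_, by abel⟩⟩
  · rintro ⟨x, ⟨h1, h2⟩, rfl⟩
    rw [inner_add_right, inner_add_right]
    exact ⟨by linarith, by linarith⟩
  · rw [inner_sub_right, inner_sub_right]
    exact ⟨by linarith, by linarith⟩

theorem hasRCPDataStructure_wedge {a b : Plane} (h : LinearIndependent ℝ ![a, b]) (α β : ℝ) :
    ∃ A : ℕ, HasRCPDataStructure {x : Plane | α ≤ inner ℝ a x ∧ β ≤ inner ℝ b x}
      (fun n => 602 * (A * n + 1)) (fun n => 60 * Nat.log 2 (A * n + 1) + 200) := by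
  obtain ⟨A, hA⟩ := exists_candidate_sequence h
  refine ⟨A, queryProgram a b α β, 10 + A, fun S => ?_⟩
  obtain ⟨m, P, Q, hm, hPQ⟩ := hA S
  obtain ⟨G, s, hG, hs, hreach⟩ := exists_search m
    (fun i => min (inner ℝ a (P i)) (inner ℝ a (Q i)))
    (fun i => min (inner ℝ b (P i)) (inner ℝ b (Q i)))
  -- Words are at most `5 * G.length + K + 3` with `G.length ≤ 60 * (A * n + 1)` and `K = 2 * (m +
  -- 1)`, hence below `400 * (A * n + 1)`. The exponent absorbs `A` through `A < 2 ^ A`.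
  have hB : 400 * (A * S.card + 1) < (S.card + 2) ^ (10 + A) := by
    have h1 : A < 2 ^ A := Nat.lt_two_pow_self
    have h2 : 400 * (A + 1) < 2 ^ (9 + A) := by
      rw [pow_add]
      omega
    have h3 : 2 ^ (9 + A) ≤ (S.card + 2) ^ (9 + A) := Nat.pow_le_pow_left (by omega) _
    calc 400 * (A * S.card + 1) ≤ 400 * (A + 1) * (S.card + 2) := by nlinarith
      _ < (S.card + 2) ^ (9 + A) * (S.card + 2) :=
        Nat.mul_lt_mul_of_pos_right (h2.trans_le h3) (by omega)
      _ = (S.card + 2) ^ (10 + A) := by rw [← pow_succ]; congr 1; omega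
  have hspace : G.length ≤ 60 * (A * S.card + 1) := hG.trans (by omega)
  refine ⟨storedMemory (2 * (m + 1)) m P Q G s, ?_, fun v hv => ?_, fun q => ?_⟩
  · rw [size_storedMemory]
    beta_reduce
    omega
  · have := ints_storedMemory_le v hv
    omega
  · obtain ⟨i, hi⟩ := exists_isFirst (m := m)
      (u := fun i => min (inner ℝ a (P i)) (inner ℝ a (Q i)))
      (v := fun i => min (inner ℝ b (P i)) (inner ℝ b (Q i))) (inner ℝ a q + α) (inner ℝ b q + β)
    obtain ⟨c₁, hs₁, hc₁⟩ := steps_prologue (a := a) (b := b) (α := α) (β := β)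
      (B := (S.card + 2) ^ (10 + A)) q (storedMemory (2 * (m + 1)) m P Q G s) (by omega)
      getElem?_ints_zero
    obtain ⟨τ, c, hτ, he, h0, h1, h2, h3, h4⟩ := (hreach _ _ _ hi).exec
      (B := (S.card + 2) ^ (10 + A)) (by omega) c₁ hc₁
    have hlog : Nat.log 2 (m + 1) ≤ Nat.log 2 (A * S.card + 1) := Nat.log_mono_right (by omega)
    refine ⟨τ + 16, c, by beta_reduce; omega, hs₁.exec he, ?_⟩
    rw [inter_translateOf_wedge]
    have hpt : ∀ z : Plane, !₂[z 0, z 1] = z := fun z => by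
      ext j
      fin_cases j <;> rfl
    rcases hPQ _ _ _ hi with ⟨hlt, hcp⟩ | ⟨heq, hsub⟩
    · left
      refine ⟨by rw [h0, if_pos hlt], ?_⟩
      rw [h1, h2, h3, h4, hpt, hpt]
      exact hcp
    · right
      exact ⟨by rw [h0, if_neg (by omega)], hsub⟩

end RangeClosestPair

theorem theorem5 (W : Set Plane) (hW : IsWedge W) :
    ∃ space time : ℕ → ℕ,
      (fun n : ℕ => (space n : ℝ)) =O[atTop] (fun n : ℕ => (n : ℝ)) ∧
      (fun n : ℕ => (time n : ℝ)) =O[atTop] (fun n : ℕ => Real.log (n : ℝ)) ∧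
      HasRCPDataStructure W space time := by
  obtain ⟨a, b, α, β, h, rfl⟩ := hW
  obtain ⟨A, hA⟩ := RangeClosestPair.hasRCPDataStructure_wedge h α β
  refine ⟨_, _, ?_, ?_, hA⟩
  · refine IsBigO.of_bound (602 * (A + 1)) ?_
    filter_upwards [eventually_ge_atTop 1] with n hn
    have hn' : (1 : ℝ) ≤ n := by exact_mod_cast hn
    rw [Real.norm_of_nonneg (by positivity), Real.norm_of_nonneg (by positivity)]
    push_cast
    nlinarith
  · refine IsBigO.of_bound (60 * (Real.log (A + 1) + 1) / Real.log 2 + 200) ?_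
    -- From `n = 3` on, `1 ≤ Real.log n`, so additive constants are absorbed.
    filter_upwards [eventually_ge_atTop 3] with n hn
    have hn' : (3 : ℝ) ≤ n := by exact_mod_cast hn
    have hlog2 : 0 < Real.log 2 := Real.log_pos (by norm_num)
    have hA0 : 0 ≤ Real.log (A + 1) := Real.log_nonneg (by linarith [A.cast_nonneg (α := ℝ)])
    have hlogn : 1 ≤ Real.log n := by
      rw [Real.le_log_iff_exp_le (by linarith)]
      linarith [Real.exp_one_lt_d9]
    have h1 : (Nat.log 2 (A * n + 1) : ℝ) ≤ Real.log (A * n + 1) / Real.log 2 := by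
      have := Real.natLog_le_logb (A * n + 1) 2
      rw [Real.logb] at this
      push_cast at this
      exact this
    have h2 : Real.log (A * n + 1) ≤ Real.log (A + 1) + Real.log n := by
      rw [← Real.log_mul (by positivity) (by positivity)]
      apply Real.log_le_log (by positivity)
      nlinarith
    have h3 : (Nat.log 2 (A * n + 1) : ℝ) ≤
        (Real.log (A + 1) + 1) / Real.log 2 * Real.log n := by
      refine h1.trans ?_
      rw [div_mul_eq_mul_div]
      gcongr
      nlinarith
    rw [Real.norm_of_nonneg (by positivity), Real.norm_of_nonneg (by linarith)]
    push_cast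
    rw [mul_div_assoc]
    nlinarith
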